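/- There are absolute constants $C_1,C_2>0$ such that the following holds. Let $G=(V,E)$ be a connected simple undirected graph with $n\ge 2$ vertices (resources), average degree $d$ and minimum degree $\delta$. Let $\mathbf P$ be the transition matrix of the simple random walk on $G$ ($\mathbf P_{u,v}=1/\deg(u)$ if $\{u,v\}\in E$, and $0$ otherwise), let $\mu=1-\max\{|\lambda| : \lambda \text{ an eigenvalue of } \mathbf P,\ |\lambda|<1\}$ (the maximum of the empty set being $0$), and let $\mathsf{MIX}(G)=4\log n/\mu$. Let $m$ users be given, put $\overline T=\lceil m/n\rceil$, let $\varepsilon_{\min}>0$, and let each resource $v$ have a threshold $T_v\ge(1+\varepsilon_{\min})\overline T$ (the same for all users). A state assigns each user to a resource; if $x_v$ users are assigned to $v$, put $\Phi_v(x)=x_v-k$, where $k$ is the largest element of $\{1,\dots,x_v\}$ with $k\le T_v$ ($k=0$ if there is none), so that $\Phi_v(x)=\max\{x_v-T_v,0\}$ for integer $T_v$; the potential is $\Phi(x)=\sum_{v\in V}\Phi_v(x)$. In each round of the user-controlled protocol all users act concurrently and independently: a user on $v$ decides to migrate with probability $\alpha\,\Phi_v(x)/x_v$, where $\alpha=1/(2e)$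 and $x$ is the current profile; if it migrates, it moves to a uniformly random neighbour of $v$, and otherwise it stays. Put $\varepsilon=\min\{\varepsilon_{\min},1\}$ (so $\varepsilon=\varepsilon_{\min}$ when $\varepsilon_{\min}\le1$). Then from every initial state the expected number of rounds until the protocol first reaches a state with potential \[ \Phi(x)\ \le\ C_1\, n\cdot\frac{d}{\delta\,\varepsilon}\cdot\mathsf{MIX}(G) \] is at most \[ C_2\,\frac1{\varepsilon}\cdot\frac d\delta\cdot\mathsf{MIX}(G)\cdot\log m . \] -/

import Mathlib

open scoped ENNReal NNReal

noncomputable section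

namespace ThresholdBalancing

/-! ### The random walk on a graph -/

section Graph

variable {V : Type*} [Fintype V] [DecidableEq V] (G : SimpleGraph V) [DecidableRel G.Adj]

/-- The transition matrix of the simple random walk: `P u v = 1 / deg u` if `u` and `v` are adjacent
and `P u v = 0` otherwise. -/
def walkMatrix : Matrix V V ℝ :=
  Matrix.of fun u v => if G.Adj u v then 1 / (G.degree u : ℝ) else 0

/-- The number `1 - max |λ|`, over the eigenvalues `λ` of the transition matrix with `|λ| < 1`.
The set is finite, so that the supremum is a maximum; it is empty only for the graph with two vertices
and one edge (among connected graphs with at least two vertices), and then the maximum is `0`. -/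
def spectralMu : ℝ :=
  1 - sSup {r : ℝ | ∃ ev : ℝ,
    Module.End.HasEigenvalue (Matrix.toLin' (walkMatrix G)) ev ∧ |ev| < 1 ∧ r = |ev|}

/-- The mixing time `4 log n / μ`. -/
def mixTime : ℝ := 4 * Real.log (Fintype.card V) / spectralMu G

/-- The average degree. -/
def avgDegree : ℝ := (∑ v, (G.degree v : ℝ)) / Fintype.card V

end Graph

/-! ### States, loads and the potential -/

/-- A state assigns each of the `m` users to a resource. -/
def State (V : Type*) (m : ℕ) : Type _ := Fin m → V

/-- The resource to which user `i` is assigned. -/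
def State.resource {V : Type*} {m : ℕ} (a : State V m) (i : Fin m) : V := a i

section States

variable {V : Type*} [DecidableEq V] {m : ℕ}

instance [Fintype V] : Fintype (State V m) := inferInstanceAs (Fintype (Fin m → V))

/-- States form a finite set; every set of states is measurable. -/
instance : MeasurableSpace (State V m) := ⊤

/-- The load of resource `v`: the number of users assigned to it. -/
def load (a : State V m) (v : V) : ℕ := (Finset.univ.filter fun i : Fin m => a.resource i = v).card

/-- The contribution `x_v - k` of resource `v` to the potential, where `k` is the last position in
`{1, …, x_v}` with `k ≤ T v`, and `k = 0` if there is none. (All users have the same threshold `T v`,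
so their ranking is immaterial. If `T v` is an integer, this is `max (x_v - T v) 0`.) -/
def potentialAt (T : V → ℝ) (a : State V m) (v : V) : ℕ :=
  load a v - Nat.findGreatest (fun k => (k : ℝ) ≤ T v) (load a v)

/-- The potential of a state. -/
def potential [Fintype V] (T : V → ℝ) (a : State V m) : ℕ := ∑ v, potentialAt T a v

end States

/-- The average `⌈m / n⌉` of `m` users over `n` resources. -/
def avgLoad (n m : ℕ) : ℕ := ⌈(m : ℝ) / (n : ℝ)⌉₊

/-! ### The user-controlled protocol -/

/-- The constant `α = 1 / (2e)` of the migration probabilities. -/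
def migrationRate : ℝ := 1 / (2 * Real.exp 1)

theorem migrationRate_nonneg : 0 ≤ migrationRate := by
  unfold migrationRate; positivity

theorem migrationRate_le_one : migrationRate ≤ 1 := by
  unfold migrationRate
  rw [div_le_one (by positivity)]
  have := Real.add_one_le_exp (1 : ℝ)
  linarith

/-- The toss of a coin that shows `true` with probability `p`. -/
def coin (p : ℝ) (h0 : 0 ≤ p) (h1 : p ≤ 1) : PMF Bool :=
  PMF.ofFintype (fun b => cond b (ENNReal.ofReal p) (ENNReal.ofReal (1 - p))) (by
    simp only [Fintype.sum_bool, cond_true, cond_false]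
    rw [← ENNReal.ofReal_add h0 (by linarith)]
    simp)

section Protocol

/-- The probability `α Φ_v / x_v` with which a user on `v` decides to migrate. -/
def migrationProb {V : Type*} [DecidableEq V] {m : ℕ} (T : V → ℝ) (a : State V m) (v : V) : ℝ :=
  migrationRate * ((potentialAt T a v : ℝ) / (load a v : ℝ))

theorem migrationProb_nonneg {V : Type*} [DecidableEq V] {m : ℕ}
    (T : V → ℝ) (a : State V m) (v : V) : 0 ≤ migrationProb T a v :=
  mul_nonneg migrationRate_nonneg (by positivity)

theorem migrationProb_le_one {V : Type*} [DecidableEq V] {m : ℕ}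
    (T : V → ℝ) (a : State V m) (v : V) : migrationProb T a v ≤ 1 := by
  refine mul_le_one₀ migrationRate_le_one (by positivity) (div_le_one_of_le₀ ?_ (by positivity))
  exact_mod_cast Nat.sub_le _ _

variable {V : Type*} [Fintype V] [DecidableEq V] {m : ℕ}

variable (G : SimpleGraph V) [DecidableRel G.Adj]

/-- A uniformly random neighbour of `v` (or `v` itself if it has no neighbour, which does not occur
in a connected graph with at least two vertices). -/
def randomNeighbor (v : V) : PMF V :=
  if h : (G.neighborFinset v).Nonempty then PMF.uniformOfFinset (G.neighborFinset v) h else PMF.pure v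

/-- The new resource of user `i` after one round from state `a`. -/
def userMove (T : V → ℝ) (a : State V m) (i : Fin m) : PMF V :=
  (coin (migrationProb T a (a.resource i)) (migrationProb_nonneg T a (a.resource i))
    (migrationProb_le_one T a (a.resource i))).bind
    fun b => if b then randomNeighbor G (a.resource i) else PMF.pure (a.resource i)

/-- The state after one round from state `a`: all users move independently and concurrently. -/
def roundLaw (T : V → ℝ) (a : State V m) : PMF (State V m) :=
  PMF.ofFintype (fun b => ∏ i, userMove G T a i (b.resource i)) (by
    have h := Finset.prod_univ_sum (fun _ : Fin m => (Finset.univ : Finset V))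
      (fun i w => userMove G T a i w)
    rw [Fintype.piFinset_univ] at h
    refine h.symm.trans (Finset.prod_eq_one fun i _ => ?_)
    rw [← tsum_fintype (L := .unconditional _)]
    exact (userMove G T a i).tsum_coe)

/-- One round of the protocol as a Markov kernel on states. -/
def roundKernel (T : V → ℝ) : ProbabilityTheory.Kernel (State V m) (State V m) where
  toFun a := (roundLaw G T a).toMeasure
  measurable' := measurable_from_top

instance (T : V → ℝ) : ProbabilityTheory.IsMarkovKernel (roundKernel (m := m) G T) :=
  ⟨fun a => inferInstanceAs (MeasureTheory.IsProbabilityMeasure (roundLaw G T a).toMeasure)⟩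

/-- The law of the sequence of states `a⁰, a¹, a², …` of the protocol that starts in state `a₀`:
the Markov chain on states whose transitions are given by one round. -/
def protocolLaw (T : V → ℝ) (a₀ : State V m) : MeasureTheory.Measure (ℕ → State V m) :=
  ProbabilityTheory.Kernel.traj (X := fun _ => State V m)
    (fun t => (roundKernel G T).comap
      (fun past : (Finset.Iic t) → State V m => past ⟨t, Finset.mem_Iic.2 le_rfl⟩)
      (measurable_pi_apply _))
    0 (fun _ => a₀)

/-- The first round in which the potential is at most `β` (`∞` if there is none). -/
def hittingRound (T : V → ℝ) (β : ℝ) (ω : ℕ → State V m) : ℝ≥0∞ :=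
  ⨅ (t : ℕ) (_ : (potential T (ω t) : ℝ) ≤ β), (t : ℝ≥0∞)

/-- The expected number of rounds until the protocol, started in `a₀`, reaches a state with potential
at most `β`. -/
def expectedRounds (T : V → ℝ) (a₀ : State V m) (β : ℝ) : ℝ≥0∞ :=
  ∫⁻ ω, hittingRound T β ω ∂(protocolLaw G T a₀)

end Protocol

end ThresholdBalancing

end

/-! Write x for the loads, P for the walk and κ = (d/δ)·MIX. The heart is a window estimate: for
some K of order at most κ/ε, if Φ ≥ 2000nK, then about 100K rounds halve Φ in expectation
(`iterate_stateOp_potential_le`). As Φ ≤ m, about log₂ m windows then suffice (`expectedRounds_le`).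

In one round x changes by −αΦ + αPᵀΦ plus centred noise. Summed over a window of t rounds, with S_v
the total potential that v has had and M the accumulated noise, αS − αPᵀS = x⁰ − xᵗ + M. Test this
against g with 0 ≤ g ≤ K and g − Pg ≥ 1 wherever S ≠ 0: it gives αΣS ≤ Σ g(x⁰ − xᵗ + M). Such a g, a
substitute for the hitting time of a set U on which S vanishes, comes from the spectral gap, with
size MIX·vol(V)/vol(U) (`exists_laplacian_ge_one`).

For U take the resources that have never been full in the window. A resource that has been full
stays full up to L users and rare large overdrafts, where an overdraft is an outflow exceeding the
potential. Since thresholds exceed the average load by a factor 1 + ε, the full resources cannot be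
almost all of V, so |U| ≥ εn/4 (`IsLedger.card_compl_ge`).

On the right, x⁰ − xᵗ is at most the initial potential plus overdrafts, which cost at most 1 per
resource and round in expectation. The noise satisfies E ΣM² ≤ 2α E ΣS, so by Young's inequality it
is absorbed into the left side. Finally Φ grows only through overdrafts, so tΦ(xᵗ) ≤ ΣS +
t·(overdrafts), and a small ΣS forces a small final potential (`half_bound`). -/

noncomputable section

set_option linter.unusedSectionVars false

namespace ThresholdBalancing

/-! ### Spectral gap of the lazy walk and test functions with large Laplacian. -/

section Spectral

variable {V : Type*} [Fintype V] [DecidableEq V] (G : SimpleGraph V) [DecidableRel G.Adj]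

/-- The absolute values of the eigenvalues of the random walk that are smaller than `1`. -/
def smallEigenvalues : Set ℝ :=
  {r : ℝ | ∃ ev : ℝ,
    Module.End.HasEigenvalue (Matrix.toLin' (walkMatrix G)) ev ∧ |ev| < 1 ∧ r = |ev|}

theorem smallEigenvalues_finite : (smallEigenvalues G).Finite := by
  have h : {ev : ℝ | Module.End.HasEigenvalue (Matrix.toLin' (walkMatrix G)) ev}.Finite :=
    Module.End.finite_hasEigenvalue _
  refine (h.image fun ev => |ev|).subset ?_
  rintro r ⟨ev, h1, -, rfl⟩
  exact ⟨ev, h1, rfl⟩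

theorem spectralMu_pos : 0 < spectralMu G := by
  have : sSup (smallEigenvalues G) < 1 := by
    rcases (smallEigenvalues G).eq_empty_or_nonempty with h | h
    · rw [h, Real.sSup_empty]; norm_num
    · rw [(smallEigenvalues_finite G).csSup_lt_iff h]
      rintro r ⟨ev, -, h2, rfl⟩
      exact h2
  exact sub_pos.2 this

theorem spectralMu_le_one : spectralMu G ≤ 1 := by
  have : 0 ≤ sSup (smallEigenvalues G) := Real.sSup_nonneg (by rintro r ⟨ev, -, -, rfl⟩; positivity)
  exact sub_le_self _ this

theorem abs_eigenvalue_le {ev : ℝ}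
    (h : Module.End.HasEigenvalue (Matrix.toLin' (walkMatrix G)) ev) (h1 : |ev| < 1) :
    |ev| ≤ 1 - spectralMu G := by
  have : |ev| ≤ sSup (smallEigenvalues G) :=
    le_csSup (smallEigenvalues_finite G).bddAbove ⟨ev, h, h1, rfl⟩
  have e : spectralMu G = 1 - sSup (smallEigenvalues G) := rfl
  linarith

/-- One step of the random walk, acting on functions. -/
def walkOp (f : V → ℝ) (v : V) : ℝ := ∑ w, walkMatrix G v w * f w

theorem walkMatrix_nonneg (v w : V) : 0 ≤ walkMatrix G v w := by
  unfold walkMatrix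
  simp only [Matrix.of_apply]
  split_ifs <;> positivity

theorem walkOp_eq (f : V → ℝ) (v : V) :
    walkOp G f v = (∑ w ∈ G.neighborFinset v, f w) / G.degree v := by
  unfold walkOp walkMatrix
  simp only [Matrix.of_apply, ite_mul, zero_mul]
  rw [← Finset.sum_filter, ← SimpleGraph.neighborFinset_eq_filter, Finset.sum_div]
  exact Finset.sum_congr rfl fun w _ => by ring

variable {G}

theorem sum_walkMatrix (hd : ∀ v, 0 < G.degree v) (v : V) : ∑ w, walkMatrix G v w = 1 := by
  have := walkOp_eq G (fun _ => 1) v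
  simp only [walkOp, mul_one, Finset.sum_const, nsmul_eq_mul, G.card_neighborFinset_eq_degree] at this
  rw [this, div_self]
  exact_mod_cast (hd v).ne'

theorem degree_mul_walkMatrix_comm (hd : ∀ v, 0 < G.degree v) (v w : V) :
    (G.degree v : ℝ) * walkMatrix G v w = G.degree w * walkMatrix G w v := by
  have h1 : (G.degree v : ℝ) ≠ 0 := by exact_mod_cast (hd v).ne'
  have h2 : (G.degree w : ℝ) ≠ 0 := by exact_mod_cast (hd w).ne'
  unfold walkMatrix
  simp only [Matrix.of_apply, G.adj_comm w v]
  split_ifs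
  · field_simp
  · simp

/-- Reversibility: the walk is self-adjoint for the weights deg. -/
theorem sum_degree_mul_walkOp (hd : ∀ v, 0 < G.degree v) (f g : V → ℝ) :
    ∑ v, G.degree v * (g v * walkOp G f v) = ∑ v, G.degree v * (walkOp G g v * f v) := by
  have e1 : ∀ v, G.degree v * (g v * walkOp G f v)
      = ∑ w, (G.degree v * walkMatrix G v w) * (g v * f w) := fun v => by
    rw [walkOp, Finset.mul_sum, Finset.mul_sum]
    exact Finset.sum_congr rfl fun w _ => by ring
  have e2 : ∀ v, G.degree v * (walkOp G g v * f v)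
      = ∑ w, (G.degree v * walkMatrix G v w) * (g w * f v) := fun v => by
    rw [walkOp, Finset.sum_mul, Finset.mul_sum]
    exact Finset.sum_congr rfl fun w _ => by ring
  simp only [e1, e2]
  rw [Finset.sum_comm]
  refine Finset.sum_congr rfl fun v _ => Finset.sum_congr rfl fun w _ => ?_
  rw [degree_mul_walkMatrix_comm hd]

/-- Harmonic functions on a connected graph are constant. -/
theorem eq_of_walkOp_eq (hG : G.Connected) (hd : ∀ v, 0 < G.degree v) {u : V → ℝ}
    (h : ∀ v, walkOp G u v = u v) (v w : V) : u v = u w := by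
  have : (G.lapMatrix ℝ).mulVec u = 0 := by
    ext v
    have h1 : (G.degree v : ℝ) ≠ 0 := by exact_mod_cast (hd v).ne'
    have h2 := h v
    rw [walkOp_eq, div_eq_iff h1] at h2
    rw [SimpleGraph.lapMatrix_mulVec_apply, h2]
    simp only [Pi.zero_apply]; ring
  exact (SimpleGraph.lapMatrix_mulVec_eq_zero_iff_forall_reachable G).1 this v w (hG.preconnected v w)

/-- Maximum principle at a point where |u| is largest. -/
theorem abs_le_one_of_walkOp_eq (hd : ∀ v, 0 < G.degree v) {u : V → ℝ} {ev : ℝ} (hu : u ≠ 0)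
    (h : ∀ v, walkOp G u v = ev * u v) : |ev| ≤ 1 := by
  obtain ⟨v₀, hv₀⟩ := Function.ne_iff.1 hu
  obtain ⟨v, -, hv⟩ := Finset.exists_max_image Finset.univ (fun v => |u v|) ⟨v₀, Finset.mem_univ _⟩
  have hpos : 0 < |u v| := lt_of_lt_of_le (abs_pos.2 hv₀) (hv v₀ (Finset.mem_univ _))
  have : |ev| * |u v| ≤ 1 * |u v| := by
    rw [← abs_mul, ← h v, ← sum_walkMatrix hd v, Finset.sum_mul]
    refine (Finset.abs_sum_le_sum_abs _ _).trans (Finset.sum_le_sum fun w _ => ?_)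
    rw [abs_mul, abs_of_nonneg (walkMatrix_nonneg G v w)]
    exact mul_le_mul_of_nonneg_left (hv w (Finset.mem_univ _)) (walkMatrix_nonneg G v w)
  exact le_of_mul_le_mul_right this hpos

variable (G) in
/-- The symmetric normalization of the transition matrix. -/
def symmWalk : Matrix V V ℝ :=
  Matrix.of fun v w => √(G.degree v) * walkMatrix G v w / √(G.degree w)

theorem symmWalk_isHermitian (hd : ∀ v, 0 < G.degree v) : (symmWalk G).IsHermitian := by
  ext v w
  have hv : (0 : ℝ) < G.degree v := by exact_mod_cast hd v
  have hw : (0 : ℝ) < G.degree w := by exact_mod_cast hd w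
  have h1 := Real.sqrt_pos.2 hv
  have h2 := Real.sqrt_pos.2 hw
  simp only [symmWalk, Matrix.conjTranspose_apply, Matrix.of_apply, star_trivial]
  rw [div_eq_div_iff h1.ne' h2.ne']
  have h := degree_mul_walkMatrix_comm hd v w
  have e1 := Real.mul_self_sqrt hv.le
  have e2 := Real.mul_self_sqrt hw.le
  calc √(G.degree w) * walkMatrix G w v * √(G.degree w)
      = (√(G.degree w) * √(G.degree w)) * walkMatrix G w v := by ring
    _ = (√(G.degree v) * √(G.degree v)) * walkMatrix G v w := by rw [e1, e2, h]
    _ = _ := by ring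

/-- One step of the lazy random walk, acting on functions. -/
def lazyOp (G : SimpleGraph V) [DecidableRel G.Adj] (f : V → ℝ) (v : V) : ℝ :=
  (f v + walkOp G f v) / 2

theorem sum_degree_mul_lazyOp (hd : ∀ v, 0 < G.degree v) (f : V → ℝ) :
    ∑ v, G.degree v * lazyOp G f v = ∑ v, G.degree v * f v := by
  have h := sum_degree_mul_walkOp hd f (fun _ => 1)
  have h1 : ∀ v, walkOp G (fun _ => 1) v = 1 := fun v => by
    simpa [walkOp] using sum_walkMatrix hd v
  simp only [h1, one_mul] at h
  have : ∀ v, G.degree v * lazyOp G f v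
      = (G.degree v * f v + G.degree v * walkOp G f v) / 2 := fun v => by
    unfold lazyOp; ring
  simp only [this]
  rw [← Finset.sum_div, Finset.sum_add_distrib, h]
  ring

/-- The lazy walk contracts functions of mean zero. -/
theorem sum_degree_lazyOp_sq_le (hG : G.Connected) (hd : ∀ v, 0 < G.degree v) {f : V → ℝ}
    (hf : ∑ v, G.degree v * f v = 0) :
    ∑ v, G.degree v * lazyOp G f v ^ 2
      ≤ (1 - spectralMu G / 2) ^ 2 * ∑ v, G.degree v * f v ^ 2 := by
  have hdr : ∀ v, (0 : ℝ) < G.degree v := fun v => by exact_mod_cast hd v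
  have hs : ∀ v, 0 < √(G.degree v : ℝ) := fun v => Real.sqrt_pos.2 (hdr v)
  have hss : ∀ v, √(G.degree v : ℝ) * √(G.degree v : ℝ) = G.degree v :=
    fun v => Real.mul_self_sqrt (hdr v).le
  set hA := symmWalk_isHermitian hd
  set e := hA.eigenvectorBasis with he
  -- Dividing by √deg turns the eigenvectors of `symmWalk` into eigenfunctions of the walk,
  -- orthonormal for the weights deg; `c f i` are the coefficients of f in this basis.
  let u : V → V → ℝ := fun i v => e i v / √(G.degree v)
  let c : (V → ℝ) → V → ℝ := fun f i => ∑ v, G.degree v * (u i v * f v)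
  have hc : ∀ f i, c f i = inner ℝ (e i) (WithLp.toLp 2 fun v => √(G.degree v) * f v) := by
    intro f i
    rw [PiLp.inner_apply]
    refine Finset.sum_congr rfl fun v _ => ?_
    simp only [u, RCLike.inner_apply, conj_trivial]
    have h0 := (hs v).ne'
    calc (G.degree v : ℝ) * (e i v / √(G.degree v) * f v)
        = (√(G.degree v) * √(G.degree v)) * (e i v / √(G.degree v) * f v) := by rw [hss v]
      _ = √(G.degree v) * f v * e i v := by field_simp
  have pars : ∀ f, ∑ i, c f i ^ 2 = ∑ v, G.degree v * f v ^ 2 := by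
    intro f
    have h := e.sum_sq_norm_inner_right (WithLp.toLp 2 fun v => √(G.degree v) * f v)
    rw [EuclideanSpace.norm_sq_eq] at h
    simp only [← hc, Real.norm_eq_abs, sq_abs] at h
    rw [h]
    refine Finset.sum_congr rfl fun v _ => ?_
    rw [mul_pow, Real.sq_sqrt (hdr v).le]
  have hu : ∀ i v, walkOp G (u i) v = hA.eigenvalues i * u i v := by
    intro i v
    have h := congrFun (hA.mulVec_eigenvectorBasis i) v
    simp only [Matrix.mulVec, dotProduct, symmWalk, Matrix.of_apply, Pi.smul_apply,
      smul_eq_mul] at h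
    simp only [walkOp, u, ← mul_div_assoc]
    rw [eq_div_iff (hs v).ne', Finset.sum_mul]
    refine Eq.trans (Finset.sum_congr rfl fun w _ => ?_) h
    change _ = √(G.degree v) * walkMatrix G v w / √(G.degree w) * e i w
    ring
  have hu0 : ∀ i, u i ≠ 0 := by
    intro i h
    have : e i = 0 := by
      ext v
      have := congrFun h v
      simp only [u, Pi.zero_apply, div_eq_zero_iff, (hs v).ne', or_false] at this
      simpa using this
    exact e.orthonormal.ne_zero i this
  have hev : ∀ i, Module.End.HasEigenvalue (Matrix.toLin' (walkMatrix G)) (hA.eigenvalues i) := by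
    intro i
    refine Module.End.hasEigenvalue_of_hasEigenvector (x := u i) ⟨?_, hu0 i⟩
    rw [Module.End.mem_eigenspace_iff]
    ext v
    exact hu i v
  have hcl : ∀ i, c (lazyOp G f) i = (1 + hA.eigenvalues i) / 2 * c f i := by
    intro i
    have h := sum_degree_mul_walkOp hd f (u i)
    have : c (lazyOp G f) i
        = (c f i + ∑ v, G.degree v * (u i v * walkOp G f v)) / 2 := by
      simp only [c]
      rw [← Finset.sum_add_distrib, Finset.sum_div]
      exact Finset.sum_congr rfl fun v _ => by unfold lazyOp; ring
    rw [this, h]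
    have : ∑ v, G.degree v * (walkOp G (u i) v * f v) = hA.eigenvalues i * c f i := by
      simp only [c]
      rw [Finset.mul_sum]
      exact Finset.sum_congr rfl fun v _ => by rw [hu]; ring
    rw [this]; ring
  rw [← pars, ← pars, Finset.mul_sum]
  refine Finset.sum_le_sum fun i _ => ?_
  rw [hcl i, mul_pow]
  have hmu := spectralMu_pos G
  have hmu1 := spectralMu_le_one G
  have h1 := abs_le_one_of_walkOp_eq hd (hu0 i) (hu i)
  -- Eigenvalue 1 has only constant eigenfunctions, to which f is orthogonal.
  by_cases h : hA.eigenvalues i = 1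
  · have hconst : ∀ v w, u i v = u i w :=
      eq_of_walkOp_eq hG hd fun v => by rw [hu i v, h, one_mul]
    have : c f i = 0 := by
      obtain ⟨v₀⟩ := hG.nonempty
      have : c f i = u i v₀ * ∑ v, G.degree v * f v := by
        simp only [c]
        rw [Finset.mul_sum]
        exact Finset.sum_congr rfl fun v _ => by rw [hconst v v₀]; ring
      rw [this, hf, mul_zero]
    rw [this]; simp
  · refine mul_le_mul_of_nonneg_right ?_ (sq_nonneg _)
    have hle := abs_le.1 h1
    have : hA.eigenvalues i ≤ 1 - spectralMu G := by
      rcases lt_or_eq_of_le h1 with hlt | heq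
      · exact (le_abs_self _).trans (abs_eigenvalue_le G (hev i) hlt)
      -- `spectralMu` ignores the eigenvalue −1 of bipartite graphs. It is harmless here: the lazy
      -- walk turns λ into (1 + λ)/2 ≥ 0, so an upper bound on λ is enough.
      · rcases (abs_eq zero_le_one).1 heq with h' | h'
        · exact absurd h' h
        · rw [h']; linarith
    exact pow_le_pow_left₀ (by linarith) (by linarith) 2

theorem iterate_lazyOp_mean_zero (hd : ∀ v, 0 < G.degree v) {f : V → ℝ}
    (hf : ∑ v, G.degree v * f v = 0) (N : ℕ) :
    ∑ v, G.degree v * ((lazyOp G)^[N] f) v = 0 := by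
  induction N with
  | zero => simpa using hf
  | succ N ih => rw [Function.iterate_succ_apply', sum_degree_mul_lazyOp hd, ih]

theorem sum_degree_iterate_lazyOp_sq_le (hG : G.Connected) (hd : ∀ v, 0 < G.degree v) {f : V → ℝ}
    (hf : ∑ v, G.degree v * f v = 0) (N : ℕ) :
    ∑ v, G.degree v * ((lazyOp G)^[N] f) v ^ 2
      ≤ (1 - spectralMu G / 2) ^ (2 * N) * ∑ v, G.degree v * f v ^ 2 := by
  induction N with
  | zero => simp
  | succ N ih =>
    rw [Function.iterate_succ_apply']
    refine (sum_degree_lazyOp_sq_le hG hd (iterate_lazyOp_mean_zero hd hf N)).trans ?_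
    rw [mul_add, pow_add, mul_comm (_ ^ (2 * N)), mul_assoc, mul_one]
    exact mul_le_mul_of_nonneg_left ih (sq_nonneg _)

theorem iterate_lazyOp_bounds (hd : ∀ v, 0 < G.degree v) {f : V → ℝ} {a b : ℝ}
    (h : ∀ v, a ≤ f v ∧ f v ≤ b) (N : ℕ) (v : V) :
    a ≤ ((lazyOp G)^[N] f) v ∧ ((lazyOp G)^[N] f) v ≤ b := by
  induction N generalizing v with
  | zero => simpa using h v
  | succ N ih =>
    rw [Function.iterate_succ_apply']
    have h1 : a ≤ walkOp G ((lazyOp G)^[N] f) v := by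
      rw [← mul_one a, ← sum_walkMatrix hd v, Finset.mul_sum]
      refine Finset.sum_le_sum fun w _ => ?_
      rw [mul_comm]
      exact mul_le_mul_of_nonneg_left (ih w).1 (walkMatrix_nonneg G v w)
    have h2 : walkOp G ((lazyOp G)^[N] f) v ≤ b := by
      rw [← mul_one b, ← sum_walkMatrix hd v, Finset.mul_sum]
      refine Finset.sum_le_sum fun w _ => ?_
      rw [mul_comm b]
      exact mul_le_mul_of_nonneg_left (ih w).2 (walkMatrix_nonneg G v w)
    have h3 := ih v
    rw [lazyOp]
    constructor <;> linarith [h3.1, h3.2]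

theorem lazyOp_sum {ι : Type*} (s : Finset ι) (F : ι → V → ℝ) (v : V) :
    lazyOp G (fun v => ∑ j ∈ s, F j v) v = ∑ j ∈ s, lazyOp G (F j) v := by
  unfold lazyOp walkOp
  rw [← Finset.sum_div, Finset.sum_add_distrib, Finset.sum_comm (s := s)]
  simp only [Finset.mul_sum]

/-- A bounded nonnegative function whose walk Laplacian is at least `1` outside of `U`. -/
theorem exists_laplacian_ge_one (hG : G.Connected) (hd : ∀ v, 0 < G.degree v)
    (hn : 2 ≤ Fintype.card V) {U : Finset V} (hU : U.Nonempty) :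
    ∃ g : V → ℝ, (∀ v, 0 ≤ g v) ∧
      (∀ v, g v ≤ 6 * mixTime G * ((∑ v, (G.degree v : ℝ)) / ∑ v ∈ U, (G.degree v : ℝ))) ∧
      ∀ v ∉ U, 1 ≤ g v - walkOp G g v := by
  have hdr : ∀ v, (1 : ℝ) ≤ G.degree v := fun v => by exact_mod_cast hd v
  set n : ℝ := (Fintype.card V : ℝ) with hndef
  have hn2 : (2 : ℝ) ≤ n := by rw [hndef]; exact_mod_cast hn
  set vol := ∑ v, (G.degree v : ℝ) with hvol
  set volU := ∑ v ∈ U, (G.degree v : ℝ) with hvolU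
  have hvolU1 : 1 ≤ volU := by
    obtain ⟨w, hw⟩ := hU
    exact (hdr w).trans (Finset.single_le_sum (f := fun v => (G.degree v : ℝ))
      (fun v _ => by positivity) hw)
  have hle : volU ≤ vol := Finset.sum_le_sum_of_subset_of_nonneg (Finset.subset_univ _)
    fun v _ _ => by positivity
  set r := vol / volU with hr
  have hr1 : 1 ≤ r := (one_le_div (by linarith)).2 hle
  have hvoln : vol ≤ n ^ 2 := by
    calc vol ≤ ∑ _v : V, n := Finset.sum_le_sum fun v _ => by
          rw [hndef]; exact_mod_cast (G.degree_lt_card_verts v).le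
      _ = n ^ 2 := by simp [hndef, sq]
  have hrn : r ≤ n ^ 2 := (div_le_self (by linarith) hvolU1).trans hvoln
  -- The desired Laplacian off U, corrected on U to have mean zero.
  let φ : V → ℝ := fun v => 1 - if v ∈ U then r else 0
  have hφ0 : ∑ v, G.degree v * φ v = 0 := by
    have : ∀ v, G.degree v * φ v = G.degree v - if v ∈ U then r * G.degree v else 0 := fun v => by
      simp only [φ]; split_ifs <;> ring
    simp only [this]
    rw [Finset.sum_sub_distrib, Finset.sum_ite_mem, Finset.univ_inter, ← Finset.mul_sum, hr,
      div_mul_cancel₀ _ (by linarith)]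
    exact sub_self _
  have hφb : ∀ v, -r ≤ φ v ∧ φ v ≤ 1 := fun v => by
    simp only [φ]; split_ifs <;> constructor <;> linarith
  have hmu := spectralMu_pos G
  have hmu1 := spectralMu_le_one G
  have hlogn : Real.log 2 ≤ Real.log n := Real.log_le_log (by norm_num) hn2
  have hlog2 := Real.log_two_gt_d9
  have hmix : mixTime G = 4 * Real.log n / spectralMu G := rfl
  have hmix1 : 1 ≤ mixTime G := by
    rw [hmix, one_le_div hmu]; linarith
  -- With N at least twice the mixing time the squared norm contracts by n⁻⁸, which beats its
  -- initial bound n⁶.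
  set N := ⌈2 * mixTime G⌉₊ with hN
  have hN1 : 2 * mixTime G ≤ N := Nat.le_ceil _
  have hN2 : (N : ℝ) ≤ 3 * mixTime G := by
    have := Nat.ceil_lt_add_one (a := 2 * mixTime G) (by linarith)
    linarith
  have hmuN : 8 * Real.log n ≤ spectralMu G * N := by
    calc 8 * Real.log n = spectralMu G * (2 * mixTime G) := by rw [hmix]; field_simp; ring
      _ ≤ _ := by gcongr
  have hsmall : ∀ v, |((lazyOp G)^[N] φ) v| ≤ 1 / 2 := by
    intro v
    have h1 := sum_degree_iterate_lazyOp_sq_le hG hd hφ0 N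
    have h2 : ((lazyOp G)^[N] φ) v ^ 2 ≤ ∑ v, G.degree v * ((lazyOp G)^[N] φ) v ^ 2 := by
      refine le_trans ?_ (Finset.single_le_sum (f := fun v =>
        (G.degree v : ℝ) * ((lazyOp G)^[N] φ) v ^ 2) (fun v _ => by positivity) (Finset.mem_univ v))
      exact le_mul_of_one_le_left (sq_nonneg _) (hdr v)
    have h3 : ∑ v, G.degree v * φ v ^ 2 ≤ n ^ 6 := by
      calc ∑ v, G.degree v * φ v ^ 2 ≤ ∑ v, G.degree v * r ^ 2 := by
            refine Finset.sum_le_sum fun v _ => mul_le_mul_of_nonneg_left ?_ (by positivity)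
            exact sq_le_sq' (hφb v).1 ((hφb v).2.trans hr1)
        _ = vol * r ^ 2 := by rw [← Finset.sum_mul]
        _ ≤ n ^ 2 * (n ^ 2) ^ 2 := by gcongr
        _ = n ^ 6 := by ring
    have h4 : (1 - spectralMu G / 2) ^ (2 * N) ≤ Real.exp (-(8 * Real.log n)) := by
      calc (1 - spectralMu G / 2) ^ (2 * N) ≤ Real.exp (-(spectralMu G / 2)) ^ (2 * N) := by
            refine pow_le_pow_left₀ (by linarith) ?_ _
            have := Real.add_one_le_exp (-(spectralMu G / 2))
            linarith
        _ = Real.exp (-(spectralMu G * N)) := by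
            rw [← Real.exp_nat_mul]; congr 1; push_cast; ring
        _ ≤ _ := Real.exp_le_exp.2 (by linarith)
    have h5 : Real.exp (-(8 * Real.log n)) * n ^ 8 = 1 := by
      have : n ^ 8 = Real.exp (8 * Real.log n) := by
        rw [mul_comm, Real.exp_mul, Real.exp_log (by linarith)]; norm_cast
      rw [this, ← Real.exp_add]; simp
    have h6 : Real.exp (-(8 * Real.log n)) * n ^ 6 ≤ 1 / 4 := by
      have hp : 0 ≤ Real.exp (-(8 * Real.log n)) * n ^ 6 := by positivity
      have : Real.exp (-(8 * Real.log n)) * n ^ 6 * n ^ 2 = 1 := by rw [← h5]; ring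
      nlinarith
    have h7 : ((lazyOp G)^[N] φ) v ^ 2 ≤ (1 / 2) ^ 2 := by
      calc _ ≤ _ := h2
        _ ≤ _ := h1
        _ ≤ Real.exp (-(8 * Real.log n)) * n ^ 6 := by
            gcongr
        _ ≤ _ := h6.trans (by norm_num)
    exact abs_le_of_sq_le_sq h7 (by norm_num)
  -- Truncated Neumann series for the inverse of the lazy Laplacian; it telescopes.
  let f : V → ℝ := fun v => ∑ j ∈ Finset.range N, ((lazyOp G)^[j] φ) v
  have hfb : ∀ v, -(N * r) ≤ f v ∧ f v ≤ N := by
    intro v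
    constructor
    · have : ∑ _j ∈ Finset.range N, -r ≤ f v := Finset.sum_le_sum fun j _ =>
        (iterate_lazyOp_bounds hd hφb j v).1
      simpa using this
    · have : f v ≤ ∑ _j ∈ Finset.range N, (1 : ℝ) := Finset.sum_le_sum fun j _ =>
        (iterate_lazyOp_bounds hd hφb j v).2
      simpa using this
  have hlap : ∀ v, f v - lazyOp G f v = φ v - ((lazyOp G)^[N] φ) v := by
    intro v
    rw [lazyOp_sum, ← Finset.sum_sub_distrib]
    simp only [← Function.iterate_succ_apply' (lazyOp G)]
    exact Finset.sum_range_sub' (fun j => ((lazyOp G)^[j] φ) v) N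
  -- The shift makes f nonnegative and is invisible to the Laplacian. The lazy Laplacian is half the
  -- true one, so its lower bound 1 − 1/2 becomes 1.
  refine ⟨fun v => f v + N * r, fun v => by linarith [(hfb v).1], fun v => ?_, fun v hv => ?_⟩
  · calc f v + N * r ≤ N * r + N * r := by
          have : (N : ℝ) ≤ N * r := le_mul_of_one_le_right (by positivity) hr1
          linarith [(hfb v).2]
      _ = 2 * N * r := by ring
      _ ≤ 2 * (3 * mixTime G) * r := by gcongr
      _ = _ := by ring
  · have h1 : walkOp G (fun v => f v + N * r) v = walkOp G f v + N * r := by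
      unfold walkOp
      simp only [mul_add]
      rw [Finset.sum_add_distrib, ← Finset.sum_mul, sum_walkMatrix hd, one_mul]
    have h2 := hlap v
    have h3 := abs_le.1 (hsmall v)
    have h4 : φ v = 1 := by simp [φ, hv]
    rw [h4] at h2
    have h5 : lazyOp G f v = (f v + walkOp G f v) / 2 := rfl
    rw [h5] at h2
    rw [h1]
    dsimp only
    linarith [h3.2]

end Spectral

/-! ### Moments under a product of independent laws. -/

section ProductWeights

variable {ι V : Type*} [Fintype ι] [DecidableEq ι] [Fintype V] {q : ι → V → ℝ}

theorem sum_prod_mul_prod (q f : ι → V → ℝ) :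
    ∑ b : ι → V, (∏ i, q i (b i)) * ∏ i, f i (b i) = ∏ i, ∑ w, q i w * f i w := by
  rw [Finset.prod_univ_sum, Fintype.piFinset_univ]
  exact Finset.sum_congr rfl fun b _ => Finset.prod_mul_distrib.symm

theorem sum_prod_eq_one (hq : ∀ i, ∑ w, q i w = 1) : ∑ b : ι → V, ∏ i, q i (b i) = 1 := by
  have := sum_prod_mul_prod q (fun _ _ => 1)
  simpa [hq] using this

theorem sum_prod_mul_apply (hq : ∀ i, ∑ w, q i w = 1) (i : ι) (f : V → ℝ) :
    ∑ b : ι → V, (∏ k, q k (b k)) * f (b i) = ∑ w, q i w * f w := by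
  have h := sum_prod_mul_prod q (fun k w => if k = i then f w else 1)
  have e : ∀ k, ∑ w, q k w * (if k = i then f w else 1)
      = if k = i then ∑ w, q i w * f w else 1 := fun k => by
    split_ifs with hk
    · rw [hk]
    · simp [hq]
  simp only [e] at h
  simpa [Finset.prod_ite_eq'] using h

theorem sum_prod_mul_apply_mul_apply (hq : ∀ i, ∑ w, q i w = 1) {i j : ι} (hij : i ≠ j)
    (f g : V → ℝ) :
    ∑ b : ι → V, (∏ k, q k (b k)) * (f (b i) * g (b j))
      = (∑ w, q i w * f w) * ∑ w, q j w * g w := by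
  have h := sum_prod_mul_prod q
    (fun k w => (if k = i then f w else 1) * (if k = j then g w else 1))
  have e : ∀ k, ∑ w, q k w * ((if k = i then f w else 1) * (if k = j then g w else 1))
      = (if k = i then ∑ w, q i w * f w else 1) * (if k = j then ∑ w, q j w * g w else 1) :=
    fun k => by
      by_cases hk : k = i
      · have : k ≠ j := fun h => hij (hk.symm.trans h)
        simp [hk, hij]
      · by_cases hk' : k = j
        · simp [hk', hij.symm]
        · simp [hk, hk', hq]
  simp only [e, Finset.prod_mul_distrib] at h
  simpa [Finset.prod_ite_eq'] using h

/-- The second moment of a sum of independent centred variables. -/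
theorem sum_prod_mul_sum_sq (hq : ∀ i, ∑ w, q i w = 1) (f : ι → V → ℝ)
    (hf : ∀ i, ∑ w, q i w * f i w = 0) :
    ∑ b : ι → V, (∏ k, q k (b k)) * (∑ i, f i (b i)) ^ 2 = ∑ i, ∑ w, q i w * f i w ^ 2 := by
  have e1 : ∀ b : ι → V, (∏ k, q k (b k)) * (∑ i, f i (b i)) ^ 2
      = ∑ i, ∑ j, (∏ k, q k (b k)) * (f i (b i) * f j (b j)) := fun b => by
    rw [sq, Finset.sum_mul_sum, Finset.mul_sum]
    exact Finset.sum_congr rfl fun i _ => Finset.mul_sum _ _ _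
  simp only [e1]
  rw [Finset.sum_comm]
  refine Finset.sum_congr rfl fun i _ => ?_
  rw [Finset.sum_comm, Finset.sum_eq_single i]
  · rw [sum_prod_mul_apply hq i (fun w => f i w * f i w)]
    exact Finset.sum_congr rfl fun w _ => by ring
  · intro j _ hj
    rw [sum_prod_mul_apply_mul_apply hq hj.symm, hf, zero_mul]
  · simp

end ProductWeights

/-! ### One round: drift, variance and overdrafts. -/

section OneRound

variable {V : Type*} [Fintype V] [DecidableEq V] {m : ℕ}
variable {G : SimpleGraph V} [DecidableRel G.Adj] {T : V → ℝ}

theorem potentialAt_eq {v : V} (hT : 0 ≤ T v) (a : State V m) :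
    potentialAt T a v = load a v - ⌊T v⌋₊ := by
  have : Nat.findGreatest (fun k => (k : ℝ) ≤ T v) (load a v) = min (load a v) ⌊T v⌋₊ := by
    rw [Nat.findGreatest_eq_iff]
    refine ⟨min_le_left _ _, fun _ => (Nat.le_floor_iff hT).1 (min_le_right _ _), ?_⟩
    intro k hk1 hk2 hk3
    have := (Nat.le_floor_iff hT).2 hk3
    omega
  rw [potentialAt, this]
  omega

theorem potentialAt_le_load (a : State V m) (v : V) : potentialAt T a v ≤ load a v :=
  Nat.sub_le _ _

theorem sum_comp_resource (a : State V m) (F : V → ℝ) :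
    ∑ i, F (a.resource i) = ∑ v, load a v * F v := by
  rw [← Finset.sum_fiberwise Finset.univ a.resource]
  refine Finset.sum_congr rfl fun v _ => ?_
  rw [Finset.sum_congr rfl (g := fun _ => F v) fun i hi => by rw [(Finset.mem_filter.1 hi).2]]
  simp [load]

theorem sum_load (a : State V m) : ∑ v, load a v = m := by
  have := sum_comp_resource a (fun _ => 1)
  simp only [mul_one, Finset.sum_const, Finset.card_univ, Fintype.card_fin, nsmul_eq_mul] at this
  exact_mod_cast this.symm

theorem potential_le (a : State V m) : potential T a ≤ m :=
  (Finset.sum_le_sum fun v _ => potentialAt_le_load a v).trans (sum_load a).le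

theorem load_mul_migrationProb (a : State V m) (v : V) :
    load a v * migrationProb T a v = migrationRate * potentialAt T a v := by
  unfold migrationProb
  by_cases h : load a v = 0
  · have := potentialAt_le_load (T := T) a v
    have h2 : potentialAt T a v = 0 := by omega
    simp [h, h2]
  · have : (load a v : ℝ) ≠ 0 := by exact_mod_cast h
    field_simp

variable (G T) in
/-- The probability that user `i` is on resource `w` after one round from `a`. -/
def moveProb (a : State V m) (i : Fin m) (w : V) : ℝ := (userMove G T a i w).toReal

variable (G T) in
/-- The transition probabilities of the protocol. -/
def stepProb (a b : State V m) : ℝ := ∏ i, moveProb G T a i (b.resource i)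

theorem roundLaw_eq (a b : State V m) : roundLaw G T a b = ENNReal.ofReal (stepProb G T a b) := by
  have : stepProb G T a b = (roundLaw G T a b).toReal := by
    exact (map_prod ENNReal.toRealHom _ _).symm
  rw [this, ENNReal.ofReal_toReal (PMF.apply_ne_top _ _)]

theorem moveProb_nonneg (a : State V m) (i : Fin m) (w : V) : 0 ≤ moveProb G T a i w :=
  ENNReal.toReal_nonneg

theorem stepProb_nonneg (a b : State V m) : 0 ≤ stepProb G T a b :=
  Finset.prod_nonneg fun i _ => moveProb_nonneg a i _

theorem randomNeighbor_toReal (hd : ∀ v, 0 < G.degree v) (v w : V) :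
    (randomNeighbor G v w).toReal = walkMatrix G v w := by
  have h : (G.neighborFinset v).Nonempty := by
    rw [← Finset.card_pos, G.card_neighborFinset_eq_degree]; exact hd v
  rw [randomNeighbor, dif_pos h, PMF.uniformOfFinset_apply]
  simp only [walkMatrix, Matrix.of_apply, SimpleGraph.mem_neighborFinset,
    G.card_neighborFinset_eq_degree]
  split_ifs <;> simp

theorem moveProb_eq (hd : ∀ v, 0 < G.degree v) (a : State V m) (i : Fin m) (w : V) :
    moveProb G T a i w = migrationProb T a (a.resource i) * walkMatrix G (a.resource i) w
      + (1 - migrationProb T a (a.resource i)) * if a.resource i = w then 1 else 0 := by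
  have h0 := migrationProb_nonneg T a (a.resource i)
  have h1 := migrationProb_le_one T a (a.resource i)
  rw [moveProb, userMove, PMF.bind_apply, tsum_bool, ENNReal.toReal_add]
  · simp only [coin, PMF.ofFintype_apply, cond_true, cond_false, ENNReal.toReal_mul,
      if_true, Bool.false_eq_true, if_false, PMF.pure_apply, randomNeighbor_toReal hd]
    rw [ENNReal.toReal_ofReal h0, ENNReal.toReal_ofReal (by linarith), add_comm]
    congr 2
    simp only [eq_comm (a := w)]
    split_ifs <;> simp
  · exact ENNReal.mul_ne_top (PMF.apply_ne_top _ _) (PMF.apply_ne_top _ _)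
  · exact ENNReal.mul_ne_top (PMF.apply_ne_top _ _) (PMF.apply_ne_top _ _)

theorem sum_moveProb (a : State V m) (i : Fin m) : ∑ w, moveProb G T a i w = 1 := by
  unfold moveProb
  rw [← ENNReal.toReal_sum (fun w _ => PMF.apply_ne_top _ _),
    ← tsum_fintype (L := .unconditional _), PMF.tsum_coe]
  rfl

theorem sum_stepProb (a : State V m) : ∑ b, stepProb G T a b = 1 :=
  sum_prod_eq_one (q := moveProb G T a) (sum_moveProb a)

theorem walkMatrix_self (v : V) : walkMatrix G v v = 0 := by simp [walkMatrix]

theorem moveProb_self (hd : ∀ v, 0 < G.degree v) (a : State V m) (i : Fin m) :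
    moveProb G T a i (a.resource i) = 1 - migrationProb T a (a.resource i) := by
  rw [moveProb_eq hd, walkMatrix_self]; simp

variable (G T) in
/-- The expected load of `v` after one round. -/
def meanLoad (a : State V m) (v : V) : ℝ :=
  load a v - migrationRate * potentialAt T a v
    + migrationRate * ∑ u, potentialAt T a u * walkMatrix G u v

theorem meanLoad_eq (hd : ∀ v, 0 < G.degree v) (a : State V m) (v : V) :
    meanLoad G T a v = ∑ i, moveProb G T a i v := by
  simp only [moveProb_eq hd]
  rw [sum_comp_resource a (fun u => migrationProb T a u * walkMatrix G u v
    + (1 - migrationProb T a u) * if u = v then 1 else 0)]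
  have : ∀ u, load a u * (migrationProb T a u * walkMatrix G u v
      + (1 - migrationProb T a u) * if u = v then 1 else 0)
      = migrationRate * (potentialAt T a u * walkMatrix G u v)
        + if u = v then load a u - migrationRate * potentialAt T a u else 0 := fun u => by
    rw [mul_add, ← mul_assoc, load_mul_migrationProb, ← mul_assoc, ← mul_assoc, mul_sub,
      load_mul_migrationProb]
    split_ifs <;> ring
  simp only [this]
  rw [Finset.sum_add_distrib, ← Finset.mul_sum, Finset.sum_ite_eq' Finset.univ v,
    if_pos (Finset.mem_univ _), meanLoad]
  ring

theorem load_eq_sum (b : State V m) (v : V) :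
    (load b v : ℝ) = ∑ i, if b.resource i = v then 1 else 0 := by
  simp [load]

theorem load_sub_meanLoad (hd : ∀ v, 0 < G.degree v) (a b : State V m) (v : V) :
    load b v - meanLoad G T a v
      = ∑ i, ((if b.resource i = v then 1 else 0) - moveProb G T a i v) := by
  rw [Finset.sum_sub_distrib, ← load_eq_sum, meanLoad_eq hd]

theorem sum_moveProb_centered (a : State V m) (i : Fin m) (v : V) :
    ∑ w, moveProb G T a i w * ((if w = v then 1 else 0) - moveProb G T a i v) = 0 := by
  simp only [mul_sub, mul_ite, mul_one, mul_zero]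
  rw [Finset.sum_sub_distrib, Finset.sum_ite_eq' Finset.univ v, if_pos (Finset.mem_univ _),
    ← Finset.sum_mul, sum_moveProb]
  ring

theorem sum_stepProb_load_sub (hd : ∀ v, 0 < G.degree v) (a : State V m) (v : V) :
    ∑ b, stepProb G T a b * (load b v - meanLoad G T a v) = 0 := by
  simp only [load_sub_meanLoad hd, Finset.mul_sum]
  rw [Finset.sum_comm]
  refine Finset.sum_eq_zero fun i _ => ?_
  exact (sum_prod_mul_apply (sum_moveProb a) i
    (fun w => (if w = v then 1 else 0) - moveProb G T a i v)).trans (sum_moveProb_centered a i v)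

/-- The total variance of the loads after one round. -/
theorem sum_stepProb_sum_sq_le (hd : ∀ v, 0 < G.degree v) (a : State V m) :
    ∑ v, ∑ b, stepProb G T a b * (load b v - meanLoad G T a v) ^ 2
      ≤ 2 * migrationRate * potential T a := by
  -- The indicator that user i ends on v has variance q(1 − q), where q = `moveProb G T a i v`;
  -- bound it by 1 − q on the user's own resource and by q elsewhere.
  have h1 : ∀ v, ∑ b, stepProb G T a b * (load b v - meanLoad G T a v) ^ 2
      ≤ ∑ i, migrationProb T a (a.resource i)
        * (walkMatrix G (a.resource i) v + if a.resource i = v then 1 else 0) := by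
    intro v
    simp only [load_sub_meanLoad hd]
    refine (sum_prod_mul_sum_sq (sum_moveProb a)
      (fun i w => (if w = v then 1 else 0) - moveProb G T a i v)
      (fun i => sum_moveProb_centered a i v)).trans_le ?_
    refine Finset.sum_le_sum fun i _ => ?_
    have e : ∑ w, moveProb G T a i w * ((if w = v then 1 else 0) - moveProb G T a i v) ^ 2
        = moveProb G T a i v * (1 - moveProb G T a i v) := by
      have : ∀ w, moveProb G T a i w * ((if w = v then 1 else 0) - moveProb G T a i v) ^ 2
          = (if w = v then moveProb G T a i w * (1 - 2 * moveProb G T a i v) else 0)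
            + moveProb G T a i w * moveProb G T a i v ^ 2 := fun w => by
        split_ifs <;> ring
      simp only [this]
      rw [Finset.sum_add_distrib, Finset.sum_ite_eq' Finset.univ v, if_pos (Finset.mem_univ _),
        ← Finset.sum_mul, sum_moveProb]
      ring
    rw [e]
    have hp0 := migrationProb_nonneg T a (a.resource i)
    have hp1 := migrationProb_le_one T a (a.resource i)
    have hw := walkMatrix_nonneg G (a.resource i) v
    by_cases hv : a.resource i = v
    · have := moveProb_self (T := T) hd a i
      rw [hv] at this hw hp0 hp1 ⊢
      rw [this, walkMatrix_self]
      simp only [if_true]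
      nlinarith
    · have := moveProb_eq (T := T) hd a i v
      rw [if_neg hv, mul_zero, add_zero] at this
      rw [if_neg hv, add_zero, this]
      have : 0 ≤ migrationProb T a (a.resource i) * walkMatrix G (a.resource i) v :=
        mul_nonneg hp0 hw
      nlinarith
  refine (Finset.sum_le_sum fun v _ => h1 v).trans ?_
  rw [Finset.sum_comm]
  have h2 : ∀ i : Fin m, ∑ v, migrationProb T a (a.resource i)
        * (walkMatrix G (a.resource i) v + if a.resource i = v then 1 else 0)
      = 2 * migrationProb T a (a.resource i) := fun i => by
    rw [← Finset.mul_sum, Finset.sum_add_distrib, sum_walkMatrix hd, Finset.sum_ite_eq Finset.univ,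
      if_pos (Finset.mem_univ _)]
    ring
  simp only [h2]
  rw [← Finset.mul_sum, sum_comp_resource a (fun u => migrationProb T a u)]
  simp only [load_mul_migrationProb]
  rw [← Finset.mul_sum, potential]
  push_cast
  exact (mul_assoc _ _ _).symm.le

/-- The number of users that leave `v` between the states `a` and `b`. -/
def outflow (a b : State V m) (v : V) : ℕ :=
  (Finset.univ.filter fun i : Fin m => a.resource i = v ∧ b.resource i ≠ v).card

/-- The number of users that arrive on `v` between the states `a` and `b`. -/
def inflow (a b : State V m) (v : V) : ℕ :=
  (Finset.univ.filter fun i : Fin m => a.resource i ≠ v ∧ b.resource i = v).card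

theorem load_add_outflow (a b : State V m) (v : V) :
    load b v + outflow a b v = load a v + inflow a b v := by
  simp only [load, outflow, inflow, Finset.card_filter]
  rw [← Finset.sum_add_distrib, ← Finset.sum_add_distrib]
  refine Finset.sum_congr rfl fun i _ => ?_
  by_cases h1 : a.resource i = v <;> by_cases h2 : b.resource i = v <;> simp [h1, h2]

theorem sum_inflow (a b : State V m) : ∑ v, inflow a b v = ∑ v, outflow a b v := by
  have := Finset.sum_congr rfl fun v (_ : v ∈ Finset.univ) => load_add_outflow a b v
  rw [Finset.sum_add_distrib, Finset.sum_add_distrib, sum_load, sum_load] at this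
  omega

variable (T) in
/-- The number of users beyond `L` by which the number of users that leave `v` exceeds the
potential of `v`. From a resource without potential no user should leave, so that all are counted. -/
def overdraft (L : ℕ) (a b : State V m) (v : V) : ℕ :=
  if 0 < potentialAt T a v then outflow a b v - (potentialAt T a v + L) else outflow a b v

theorem outflow_le_overdraft_zero (a b : State V m) (v : V) :
    outflow a b v ≤ potentialAt T a v + overdraft T 0 a b v := by
  unfold overdraft; split_ifs <;> omega

/-- Each departure within the potential of its source lowers that potential by one and raises the
target's by at most one; only the remaining departures can increase the total. -/
theorem potential_le_add_overdraft (hT : ∀ v, 0 ≤ T v) (a b : State V m) :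
    potential T b ≤ potential T a + ∑ v, overdraft T 0 a b v := by
  have h : ∀ v, potentialAt T b v + outflow a b v
      ≤ potentialAt T a v + inflow a b v + overdraft T 0 a b v := fun v => by
    have h1 := load_add_outflow a b v
    have h2 := potentialAt_eq (hT v) a
    have h3 := potentialAt_eq (hT v) b
    unfold overdraft
    split_ifs <;> omega
  have := Finset.sum_le_sum fun v (_ : v ∈ Finset.univ) => h v
  simp only [Finset.sum_add_distrib, sum_inflow] at this
  unfold potential
  omega

/-- A user on v contributes the factor 1 + p ≤ exp p, where p is its migration probability, and the
load times p is αΦ_v. -/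
theorem sum_stepProb_two_pow_outflow_le (hd : ∀ v, 0 < G.degree v) (a : State V m) (v : V) :
    ∑ b, stepProb G T a b * 2 ^ outflow a b v
      ≤ Real.exp (migrationRate * potentialAt T a v) := by
  have e : ∀ b : State V m, (2 : ℝ) ^ outflow a b v
      = ∏ i, (if a.resource i = v ∧ b.resource i ≠ v then 2 else 1) := fun b => by
    rw [outflow, Finset.prod_ite]; simp
  simp only [e]
  refine (sum_prod_mul_prod (moveProb G T a)
    (fun i w => if a.resource i = v ∧ w ≠ v then 2 else 1)).trans_le ?_
  have h1 : ∀ i, ∑ w, moveProb G T a i w * (if a.resource i = v ∧ w ≠ v then 2 else 1)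
      ≤ Real.exp (if a.resource i = v then migrationProb T a v else 0) := fun i => by
    by_cases hv : a.resource i = v
    · have : ∀ w, moveProb G T a i w * (if a.resource i = v ∧ w ≠ v then 2 else 1)
          = 2 * moveProb G T a i w - if w = v then moveProb G T a i w else 0 := fun w => by
        by_cases hw : w = v <;> simp [hv, hw] <;> ring
      simp only [this]
      rw [Finset.sum_sub_distrib, Finset.sum_ite_eq' Finset.univ v, if_pos (Finset.mem_univ _),
        ← Finset.mul_sum, sum_moveProb, if_pos hv]
      have := moveProb_self (T := T) hd a i
      rw [hv] at this
      rw [this]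
      have := Real.add_one_le_exp (migrationProb T a v)
      linarith
    · simp [hv, sum_moveProb]
  refine (Finset.prod_le_prod (fun i _ => Finset.sum_nonneg fun w _ =>
    mul_nonneg (moveProb_nonneg a i w) (by split_ifs <;> norm_num)) fun i _ => h1 i).trans ?_
  rw [← Real.exp_sum, sum_comp_resource a (fun u => if u = v then migrationProb T a v else 0)]
  simp only [mul_ite, mul_zero]
  rw [Finset.sum_ite_eq' Finset.univ v, if_pos (Finset.mem_univ _), load_mul_migrationProb]

theorem migrationRate_pos : 0 < migrationRate := by unfold migrationRate; positivity

theorem one_sixth_le_migrationRate : 1 / 6 ≤ migrationRate := by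
  unfold migrationRate
  have := Real.exp_one_lt_d9
  exact one_div_le_one_div_of_le (by positivity) (by linarith)

theorem migrationRate_le_half : migrationRate ≤ 1 / 2 := by
  unfold migrationRate
  have := Real.add_one_le_exp (1 : ℝ)
  exact one_div_le_one_div_of_le (by norm_num) (by linarith)

/-- Since k ≤ 2^k, the overdraft is at most 2^(outflow − Φ_v − L), and exp(αΦ_v) ≤ 2^Φ_v because α ≤
1/2 < log 2. Without potential the exponential moment is at most 1, which forces zero expected
outflow. -/
theorem sum_stepProb_overdraft_le (hd : ∀ v, 0 < G.degree v) (L : ℕ) (a : State V m) (v : V) :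
    ∑ b, stepProb G T a b * overdraft T L a b v ≤ (1 / 2) ^ L := by
  have h := sum_stepProb_two_pow_outflow_le (T := T) hd a v
  by_cases hp : 0 < potentialAt T a v
  · have h1 : ∀ b, stepProb G T a b * overdraft T L a b v
        ≤ stepProb G T a b * 2 ^ outflow a b v * (1 / 2) ^ (potentialAt T a v + L) := fun b => by
      rw [mul_assoc]
      refine mul_le_mul_of_nonneg_left ?_ (stepProb_nonneg a b)
      rw [overdraft, if_pos hp]
      rcases le_total (outflow a b v) (potentialAt T a v + L) with hle | hle
      · rw [Nat.sub_eq_zero_of_le hle, Nat.cast_zero]; positivity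
      · obtain ⟨k, hk⟩ := Nat.exists_eq_add_of_le hle
        rw [hk, Nat.add_sub_cancel_left, pow_add, mul_right_comm, ← mul_pow]
        norm_num
        exact_mod_cast Nat.lt_two_pow_self.le
    refine (Finset.sum_le_sum fun b _ => h1 b).trans ?_
    rw [← Finset.sum_mul]
    have h2 : Real.exp (migrationRate * potentialAt T a v) ≤ 2 ^ potentialAt T a v := by
      have e : (2 : ℝ) ^ potentialAt T a v = Real.exp (Real.log 2 * potentialAt T a v) := by
        rw [Real.exp_mul, Real.exp_log (by norm_num)]; norm_cast
      rw [e]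
      have := Real.log_two_gt_d9
      have := migrationRate_le_half
      gcongr
      linarith
    calc _ ≤ 2 ^ potentialAt T a v * (1 / 2 : ℝ) ^ (potentialAt T a v + L) := by
          gcongr; exact h.trans h2
      _ = (1 / 2) ^ L := by rw [pow_add, ← mul_assoc, ← mul_pow]; norm_num
  · have h0 : potentialAt T a v = 0 := by omega
    rw [h0, Nat.cast_zero, mul_zero, Real.exp_zero] at h
    have h1 : ∀ b, stepProb G T a b * overdraft T L a b v
        ≤ stepProb G T a b * 2 ^ outflow a b v - stepProb G T a b := fun b => by
      rw [← mul_sub_one]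
      refine mul_le_mul_of_nonneg_left ?_ (stepProb_nonneg a b)
      rw [overdraft, if_neg hp]
      have : outflow a b v + 1 ≤ 2 ^ outflow a b v := Nat.lt_two_pow_self
      have : (outflow a b v : ℝ) + 1 ≤ 2 ^ outflow a b v := by exact_mod_cast this
      linarith
    refine (Finset.sum_le_sum fun b _ => h1 b).trans ?_
    rw [Finset.sum_sub_distrib, sum_stepProb]
    have : (0 : ℝ) ≤ (1 / 2) ^ L := by positivity
    linarith

end OneRound

/-! ### Expectations along the chain as powers of a linear operator. -/

section LedgerOperator

variable {Ω Z : Type*} [Fintype Ω]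

/-- The expectation, after one step of the chain with transition probabilities `p`, of a function of
the state and of a ledger that records each step by means of `upd`. -/
def ledgerOp (p : Ω → Ω → ℝ) (upd : Ω → Ω → Z → Z) : (Ω × Z → ℝ) →ₗ[ℝ] (Ω × Z → ℝ) where
  toFun F x := ∑ b, p x.1 b * F (b, upd x.1 b x.2)
  map_add' F H := by
    ext x; simp only [Pi.add_apply, mul_add, Finset.sum_add_distrib]
  map_smul' c F := by
    ext x
    simp only [Pi.smul_apply, smul_eq_mul, RingHom.id_apply, Finset.mul_sum]
    exact Finset.sum_congr rfl fun b _ => by ring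

variable {p : Ω → Ω → ℝ} {upd : Ω → Ω → Z → Z}

theorem ledgerOp_apply (F : Ω × Z → ℝ) (x : Ω × Z) :
    ledgerOp p upd F x = ∑ b, p x.1 b * F (b, upd x.1 b x.2) := rfl

/-- Transfers a pathwise inequality to expectations when it holds only for pairs satisfying the
invariant `I`; this avoids the trajectory measure. -/
theorem ledgerOp_pow_mono (hp : ∀ a b, 0 ≤ p a b) {I : ℕ → Ω × Z → Prop}
    (hI : ∀ k x b, I k x → I (k + 1) (b, upd x.1 b x.2)) {F H : Ω × Z → ℝ} (t : ℕ) :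
    ∀ k x, I k x → (∀ y, I (k + t) y → F y ≤ H y) →
      (ledgerOp p upd ^ t) F x ≤ (ledgerOp p upd ^ t) H x := by
  induction t with
  | zero => intro k x hx h; simpa using h x hx
  | succ t ih =>
    intro k x hx h
    rw [pow_succ', Module.End.mul_apply, Module.End.mul_apply, ledgerOp_apply, ledgerOp_apply]
    refine Finset.sum_le_sum fun b _ => mul_le_mul_of_nonneg_left ?_ (hp _ _)
    exact ih (k + 1) _ (hI k x b hx) fun y hy => h y (by rwa [add_right_comm] at hy)

theorem ledgerOp_pow_const (hp1 : ∀ a, ∑ b, p a b = 1) (c : ℝ) (t : ℕ) :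
    (ledgerOp p upd ^ t) (fun _ => c) = fun _ => c := by
  induction t with
  | zero => simp
  | succ t ih =>
    rw [pow_succ', Module.End.mul_apply, ih]
    ext x
    rw [ledgerOp_apply, ← Finset.sum_mul, hp1, one_mul]

theorem ledgerOp_pow_le (hp : ∀ a b, 0 ≤ p a b) (hp1 : ∀ a, ∑ b, p a b = 1) {F : Ω × Z → ℝ} {c : ℝ}
    (h : ∀ x, ledgerOp p upd F x ≤ F x + c) (t : ℕ) (x : Ω × Z) :
    (ledgerOp p upd ^ t) F x ≤ F x + t * c := by
  induction t with
  | zero => simp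
  | succ t ih =>
    rw [pow_succ, Module.End.mul_apply]
    have h1 := ledgerOp_pow_mono (upd := upd) hp (I := fun _ _ => True) (fun _ _ _ _ => trivial)
      (F := ledgerOp p upd F) (H := F + fun _ => c) t 0 x trivial fun y _ => h y
    rw [map_add, Pi.add_apply, ledgerOp_pow_const hp1] at h1
    push_cast
    linarith

/-- The expectation, after one step of the chain, of a function of the state. -/
def stateOp (p : Ω → Ω → ℝ) (f : Ω → ℝ) (a : Ω) : ℝ := ∑ b, p a b * f b

/-- The ledger never influences the transitions, so it can be dropped at the end. -/
theorem ledgerOp_pow_comp_fst (f : Ω → ℝ) (t : ℕ) (x : Ω × Z) :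
    (ledgerOp p upd ^ t) (fun y => f y.1) x = (stateOp p)^[t] f x.1 := by
  induction t generalizing x with
  | zero => simp
  | succ t ih =>
    rw [pow_succ', Module.End.mul_apply, Function.iterate_succ_apply', ledgerOp_apply]
    simp only [ih]
    rfl

end LedgerOperator

/-! ### A window of rounds: the expected potential is halved. -/

section Window

/-- What is recorded along a run of the protocol: the total potential `S v` that each resource has
had, the martingale part `M v` of its load, the total overdrafts `D v` and `E v`, and
the set `A` of the resources that have been full. -/
structure Ledger (V : Type*) where
  S : V → ℝ
  M : V → ℝ
  D : V → ℝ
  E : V → ℝ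
  A : Finset V

variable {V : Type*} [Fintype V] [DecidableEq V] {m : ℕ}
variable (G : SimpleGraph V) [DecidableRel G.Adj] (T : V → ℝ) (L : ℕ)

/-- The ledger after a step from `a` to `b`. -/
def recordStep (a b : State V m) (z : Ledger V) : Ledger V where
  S v := z.S v + potentialAt T a v
  M v := z.M v + (load b v - meanLoad G T a v)
  D v := z.D v + overdraft T 0 a b v
  E v := z.E v + overdraft T L a b v
  A := z.A ∪ Finset.univ.filter fun v => ⌊T v⌋₊ ≤ load b v

/-- The ledger at the start in state `a`. -/
def initialLedger (a : State V m) : Ledger V where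
  S _ := 0
  M _ := 0
  D _ := 0
  E _ := 0
  A := Finset.univ.filter fun v => ⌊T v⌋₊ ≤ load a v

/-- The properties of state and ledger, `k` rounds after a start in state `a₀`. -/
structure IsLedger (a₀ : State V m) (k : ℕ) (x : State V m × Ledger V) : Prop where
  S_nonneg : ∀ v, 0 ≤ x.2.S v
  D_nonneg : ∀ v, 0 ≤ x.2.D v
  E_nonneg : ∀ v, 0 ≤ x.2.E v
  load_eq : ∀ v, (load x.1 v : ℝ) = load a₀ v - migrationRate * x.2.S v
    + migrationRate * ∑ u, x.2.S u * walkMatrix G u v + x.2.M v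
  load_lt : ∀ v ∉ x.2.A, load x.1 v < ⌊T v⌋₊
  S_eq_zero : ∀ v ∉ x.2.A, x.2.S v = 0
  loss_le : ∀ v ∉ x.2.A, (load a₀ v : ℝ) - load x.1 v ≤ x.2.D v
  deficit_le_D : ∀ v ∈ x.2.A, (⌊T v⌋₊ : ℝ) - load x.1 v ≤ x.2.D v
  deficit_le_E : ∀ v ∈ x.2.A, (⌊T v⌋₊ : ℝ) - load x.1 v ≤ L + x.2.E v
  potential_le : (potential T x.1 : ℝ) ≤ potential T a₀ + ∑ v, x.2.D v
  sum_S_le : ∑ v, x.2.S v ≤ k * (potential T a₀ + ∑ v, x.2.D v)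
  mul_potential_le : k * (potential T x.1 : ℝ) ≤ ∑ v, x.2.S v + k * ∑ v, x.2.D v

variable {G T L}

theorem isLedger_initial (a₀ : State V m) : IsLedger G T L a₀ 0 (a₀, initialLedger T a₀) := by
  constructor <;> simp [initialLedger]
  intro v hv
  have : (⌊T v⌋₊ : ℝ) ≤ load a₀ v := by exact_mod_cast hv
  have : (0 : ℝ) ≤ L := by positivity
  linarith

theorem IsLedger.step (hT : ∀ v, 0 ≤ T v) {a₀ : State V m} {k : ℕ} {x : State V m × Ledger V}
    (h : IsLedger G T L a₀ k x) (b : State V m) :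
    IsLedger G T L a₀ (k + 1) (b, recordStep G T L x.1 b x.2) := by
  obtain ⟨a, z⟩ := x
  have hD := h.D_nonneg
  have hflow : ∀ v, (load a v : ℝ) - outflow a b v ≤ load b v := fun v => by
    have h1 := load_add_outflow a b v
    have h2 : (load a v : ℝ) ≤ load b v + outflow a b v := by exact_mod_cast (by omega)
    linarith
  have hpot := potential_le_add_overdraft hT a b
  have hpot' : (potential T b : ℝ) ≤ potential T a + ∑ v, (overdraft T 0 a b v : ℝ) := by
    exact_mod_cast hpot
  have hnot : ∀ v, v ∉ (recordStep G T L a b z).A → v ∉ z.A ∧ load b v < ⌊T v⌋₊ := fun v hv => by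
    simpa [recordStep] using hv
  have hzero : ∀ v ∉ z.A, potentialAt T a v = 0 := fun v hv => by
    have := h.load_lt v hv
    have h2 := potentialAt_eq (hT v) a
    dsimp only at this
    omega
  have hpotS : (potential T a : ℝ) = ∑ v, (potentialAt T a v : ℝ) := by
    unfold potential; push_cast; rfl
  have hDsum : 0 ≤ ∑ v, z.D v := Finset.sum_nonneg fun v _ => hD v
  have hOsum : 0 ≤ ∑ v, (overdraft T 0 a b v : ℝ) := by positivity
  -- Common core of both deficit bounds. Positive potential means a load above the threshold:
  -- earlier deficits are wiped out and only the overdraft of this round counts. Old deficits carry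
  -- over only when the potential is zero.
  have hdef : ∀ v (B : ℝ) (C : ℝ), 0 ≤ B → (overdraft T 0 a b v : ℝ) ≤ B + C → 0 ≤ B + C →
      (v ∈ z.A → potentialAt T a v = 0 →
        (⌊T v⌋₊ : ℝ) - load a v + outflow a b v ≤ B + C) →
      v ∈ (recordStep G T L a b z).A → (⌊T v⌋₊ : ℝ) - load b v ≤ B + C := by
    intro v B C hB hC hBC h0 hv
    simp only [recordStep, Finset.mem_union, Finset.mem_filter, Finset.mem_univ, true_and] at hv
    by_cases hfull : ⌊T v⌋₊ ≤ load b v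
    · have : (⌊T v⌋₊ : ℝ) ≤ load b v := by exact_mod_cast hfull
      linarith
    · have hv' : v ∈ z.A := by tauto
      have hf := hflow v
      rcases Nat.eq_zero_or_pos (potentialAt T a v) with hz | hpos
      · linarith [h0 hv' hz]
      · have h1 := potentialAt_eq (hT v) a
        have h2 : (load a v : ℝ) = ⌊T v⌋₊ + potentialAt T a v := by exact_mod_cast (by omega)
        have h3 : (outflow a b v : ℝ) ≤ potentialAt T a v + overdraft T 0 a b v := by
          exact_mod_cast outflow_le_overdraft_zero a b v
        linarith
  constructor
  · intro v
    have := h.S_nonneg v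
    simp only [recordStep]
    positivity
  · intro v
    have := hD v
    simp only [recordStep]
    positivity
  · intro v
    have := h.E_nonneg v
    simp only [recordStep]
    positivity
  · intro v
    have := h.load_eq v
    simp only [recordStep, meanLoad, add_mul, Finset.sum_add_distrib] at this ⊢
    linear_combination this
  · exact fun v hv => (hnot v hv).2
  · intro v hv
    have h1 := h.S_eq_zero v (hnot v hv).1
    have h2 := hzero v (hnot v hv).1
    simp only [recordStep] at h1 ⊢
    rw [h1, h2]; simp
  · intro v hv
    have h1 := h.loss_le v (hnot v hv).1
    have h2 := hzero v (hnot v hv).1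
    have h3 : (outflow a b v : ℝ) ≤ potentialAt T a v + overdraft T 0 a b v := by
      exact_mod_cast outflow_le_overdraft_zero a b v
    have := hflow v
    simp only [recordStep] at h1 ⊢
    rw [h2, Nat.cast_zero] at h3
    linarith
  · intro v hv
    refine hdef v (z.D v) _ (hD v) (by linarith [hD v]) (add_nonneg (hD v) (by positivity)) ?_ hv
    intro hv' hz
    have h1 := h.deficit_le_D v hv'
    have h3 : (outflow a b v : ℝ) = overdraft T 0 a b v := by simp [overdraft, hz]
    dsimp only at h1
    linarith
  · intro v hv
    have hE := h.E_nonneg v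
    dsimp only at hE
    have h4 : (overdraft T 0 a b v : ℝ) ≤ L + overdraft T L a b v := by
      have : overdraft T 0 a b v ≤ L + overdraft T L a b v := by
        unfold overdraft; split_ifs <;> omega
      exact_mod_cast this
    have h5 : (0 : ℝ) ≤ overdraft T L a b v := by positivity
    have h6 : (0 : ℝ) ≤ L := by positivity
    have := hdef v L (z.E v + overdraft T L a b v) h6 (by linarith) (by linarith) ?_ hv
    · exact this
    intro hv' hz
    have h1 := h.deficit_le_E v hv'
    have h3 : (outflow a b v : ℝ) = overdraft T L a b v := by simp [overdraft, hz]
    dsimp only at h1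
    linarith
  · have h1 := h.potential_le
    simp only [recordStep, Finset.sum_add_distrib] at h1 ⊢
    linarith
  · have h1 := h.sum_S_le
    have h2 := h.potential_le
    simp only [recordStep, Finset.sum_add_distrib] at h1 h2 ⊢
    rw [← hpotS]
    push_cast
    have : 0 ≤ (k : ℝ) * ∑ v, (overdraft T 0 a b v : ℝ) := by positivity
    linarith
  · have h1 := h.mul_potential_le
    simp only [recordStep, Finset.sum_add_distrib] at h1 ⊢
    rw [← hpotS]
    push_cast
    have h2 : (k : ℝ) * potential T b
        ≤ k * (potential T a + ∑ v, (overdraft T 0 a b v : ℝ)) := by gcongr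
    linarith

/-- While the overdrafts are small, a fraction `ε / 4` of the resources have never been full. -/
theorem IsLedger.card_compl_ge {a₀ : State V m} {k : ℕ} {x : State V m × Ledger V}
    (h : IsLedger G T L a₀ k x) {ε τ : ℝ} (hε : 0 < ε) (hε1 : ε ≤ 1)
    (hn : 0 < Fintype.card V)
    (hm : (m : ℝ) ≤ Fintype.card V * τ) (hT : ∀ v, (1 + ε) * τ ≤ T v)
    (hL : 8 * L + 4 ≤ ε * τ) (hE : ∑ v, x.2.E v ≤ Fintype.card V * L) :
    Fintype.card V * (ε / 4) ≤ ((x.2.A)ᶜ.card : ℝ) := by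
  have hnr : (0 : ℝ) < Fintype.card V := by exact_mod_cast hn
  by_contra! hlt
  have hc : ((x.2.A)ᶜ.card : ℝ) = Fintype.card V - x.2.A.card := by
    rw [Finset.card_compl, Nat.cast_sub (Finset.card_le_univ _)]
  have hL0 : (0 : ℝ) ≤ L := by positivity
  have hτ : 0 < τ := by
    by_contra! h'
    have := mul_nonpos_of_nonneg_of_nonpos hε.le h'
    linarith
  -- Each resource of A still carries (1 + ε)τ − 1 − L − E_v users, the 1 coming from the floor. If
  -- A had more than (1 − ε/4)n elements, the total would exceed m.
  have h1 : ∑ _v ∈ x.2.A, ((1 + ε) * τ - 1) ≤ ∑ v ∈ x.2.A, (load x.1 v + (L + x.2.E v)) := by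
    refine Finset.sum_le_sum fun v hv => ?_
    have h2 := h.deficit_le_E v hv
    have h3 := Nat.lt_floor_add_one (T v)
    linarith [hT v]
  have h2 : ∑ v ∈ x.2.A, (load x.1 v + (L + x.2.E v))
      ≤ ∑ v, (load x.1 v + (L + x.2.E v)) :=
    Finset.sum_le_sum_of_subset_of_nonneg (Finset.subset_univ _) fun v _ _ => by
      have := h.E_nonneg v
      positivity
  have h3 : ∑ v, (load x.1 v : ℝ) = m := by exact_mod_cast sum_load x.1
  replace h1 := h1.trans h2
  rw [Finset.sum_add_distrib, Finset.sum_add_distrib, h3] at h1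
  simp only [Finset.sum_const, nsmul_eq_mul, Finset.card_univ] at h1
  have h4 : (Fintype.card V : ℝ) * (1 - ε / 4) ≤ x.2.A.card := by linarith
  have h5 : 0 ≤ (1 + ε) * τ - 1 := by nlinarith
  have h6 := mul_le_mul_of_nonneg_right h4 h5
  have h7 : (Fintype.card V : ℝ) * ((1 - ε / 4) * ((1 + ε) * τ - 1))
      ≤ Fintype.card V * (τ + 2 * L) := by linarith
  have h8 := le_of_mul_le_mul_left h7 hnr
  nlinarith [mul_nonneg hε.le (mul_nonneg hτ.le (sub_nonneg.2 hε1))]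

/-- The total potential of a run, in terms of the noise. -/
theorem IsLedger.sum_S_le_of_card {a₀ : State V m} {k : ℕ} {x : State V m × Ledger V}
    (h : IsLedger G T L a₀ k x) (hT0 : ∀ v, 0 ≤ T v) {K : ℝ}
    {g : V → ℝ} (hg0 : ∀ v, 0 ≤ g v) (hgK : ∀ v, g v ≤ K)
    (hg : ∀ v ∈ x.2.A, 1 ≤ g v - walkOp G g v) :
    migrationRate * ∑ v, x.2.S v ≤ K * (potential T a₀ + ∑ v, x.2.D v)
      + ((∑ v, x.2.M v ^ 2) / 4 + Fintype.card V * K ^ 2) := by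
  have hα := migrationRate_pos
  have h1 : migrationRate * ∑ v, x.2.S v
      ≤ migrationRate * ∑ v, x.2.S v * (g v - walkOp G g v) := by
    refine mul_le_mul_of_nonneg_left (Finset.sum_le_sum fun v _ => ?_) hα.le
    by_cases hv : v ∈ x.2.A
    · exact le_mul_of_one_le_right (h.S_nonneg v) (hg v hv)
    · rw [h.S_eq_zero v hv]; simp
  -- The walk is moved from g to S, and the load balance equation is inserted.
  have h2 : migrationRate * ∑ v, x.2.S v * (g v - walkOp G g v)
      = ∑ w, g w * (load a₀ w - load x.1 w + x.2.M w) := by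
    have e1 : ∀ w, g w * (load a₀ w - load x.1 w + x.2.M w)
        = migrationRate * (x.2.S w * g w - ∑ u, x.2.S u * (walkMatrix G u w * g w)) := fun w => by
      rw [h.load_eq w]
      have : ∑ u, x.2.S u * (walkMatrix G u w * g w)
          = (∑ u, x.2.S u * walkMatrix G u w) * g w := by
        rw [Finset.sum_mul]; exact Finset.sum_congr rfl fun u _ => by ring
      rw [this]; ring
    simp only [e1]
    rw [← Finset.mul_sum, Finset.sum_sub_distrib, Finset.sum_comm]
    simp only [mul_sub, walkOp]
    rw [Finset.sum_sub_distrib]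
    simp only [Finset.mul_sum]
    simp only [mul_sub, Finset.mul_sum]
  have h3 : ∀ w, g w * (load a₀ w - load x.1 w + x.2.M w)
      ≤ K * (potentialAt T a₀ w + x.2.D w) + (x.2.M w ^ 2 / 4 + K ^ 2) := fun w => by
    have hΦ : (load a₀ w : ℝ) ≤ ⌊T w⌋₊ + potentialAt T a₀ w := by
      have := potentialAt_eq (hT0 w) a₀
      exact_mod_cast (by omega)
    have hb : (load a₀ w : ℝ) - load x.1 w ≤ potentialAt T a₀ w + x.2.D w := by
      by_cases hw : w ∈ x.2.A
      · linarith [h.deficit_le_D w hw]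
      · have := h.loss_le w hw
        have : (0 : ℝ) ≤ potentialAt T a₀ w := by positivity
        linarith
    have hnn : 0 ≤ (potentialAt T a₀ w : ℝ) + x.2.D w := add_nonneg (by positivity) (h.D_nonneg w)
    calc g w * (load a₀ w - load x.1 w + x.2.M w)
        ≤ g w * (potentialAt T a₀ w + x.2.D w + |x.2.M w|) := by
          refine mul_le_mul_of_nonneg_left ?_ (hg0 w)
          linarith [le_abs_self (x.2.M w)]
      _ ≤ K * (potentialAt T a₀ w + x.2.D w + |x.2.M w|) := by
          exact mul_le_mul_of_nonneg_right (hgK w) (by positivity)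
      -- Young's inequality K|M| ≤ M²/4 + K²: with E ΣM² ≤ 2α E ΣS, the weight 1/4 costs only half
      -- of the left side.
      _ ≤ _ := by nlinarith [sq_nonneg (|x.2.M w| / 2 - K), sq_abs (x.2.M w)]
  have h4 := Finset.sum_le_sum fun w (_ : w ∈ Finset.univ) => h3 w
  have h5 : (potential T a₀ : ℝ) = ∑ v, (potentialAt T a₀ v : ℝ) := by
    unfold potential; push_cast; rfl
  rw [Finset.sum_add_distrib, ← Finset.mul_sum, Finset.sum_add_distrib, Finset.sum_add_distrib,
    ← Finset.sum_div, ← h5] at h4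
  simp only [Finset.sum_const, nsmul_eq_mul, Finset.card_univ] at h4
  linarith

/-- An unconditional form, linear in the recorded quantities, that can be averaged. When ΣE exceeds
nL, the crude bound on ΣS is charged to ΣE/(nL) ≥ 1, as in Markov's inequality. -/
theorem IsLedger.sum_S_bound {a₀ : State V m} {t : ℕ} {x : State V m × Ledger V}
    (h : IsLedger G T L a₀ t x) {ε τ K : ℝ} (hε : 0 < ε) (hε1 : ε ≤ 1)
    (hn : 0 < Fintype.card V) (hT0 : ∀ v, 0 ≤ T v)
    (hm : (m : ℝ) ≤ Fintype.card V * τ) (hT : ∀ v, (1 + ε) * τ ≤ T v) (hL1 : 1 ≤ L)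
    (hL : 8 * L + 4 ≤ ε * τ) (hK : 0 ≤ K)
    (hg : ∀ U : Finset V, U.Nonempty → Fintype.card V * (ε / 4) ≤ (U.card : ℝ) →
      ∃ g : V → ℝ, (∀ v, 0 ≤ g v) ∧ (∀ v, g v ≤ K) ∧ ∀ v ∉ U, 1 ≤ g v - walkOp G g v) :
    migrationRate * ∑ v, x.2.S v ≤ (K * potential T a₀ + Fintype.card V * K ^ 2)
      + (K + migrationRate * t) * ∑ v, x.2.D v + (1 / 4) * ∑ v, x.2.M v ^ 2
      + migrationRate * t * potential T a₀ / (Fintype.card V * L) * ∑ v, x.2.E v := by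
  have hnr : (0 : ℝ) < Fintype.card V := by exact_mod_cast hn
  have hLr : (1 : ℝ) ≤ L := by exact_mod_cast hL1
  have hα := migrationRate_pos
  have hD : 0 ≤ ∑ v, x.2.D v := Finset.sum_nonneg fun v _ => h.D_nonneg v
  have hE : 0 ≤ ∑ v, x.2.E v := Finset.sum_nonneg fun v _ => h.E_nonneg v
  have hM : 0 ≤ ∑ v, x.2.M v ^ 2 := Finset.sum_nonneg fun v _ => sq_nonneg _
  have hKD : 0 ≤ K * ∑ v, x.2.D v := mul_nonneg hK hD
  have htD : 0 ≤ migrationRate * t * ∑ v, x.2.D v := by positivity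
  have hKK : 0 ≤ Fintype.card V * K ^ 2 := by positivity
  have hKΦ : 0 ≤ K * potential T a₀ := by positivity
  by_cases hgood : ∑ v, x.2.E v ≤ Fintype.card V * L
  · have hc := h.card_compl_ge hε hε1 hn hm hT hL hgood
    have hne : (x.2.A)ᶜ.Nonempty := by
      rw [← Finset.card_pos]
      have : (0 : ℝ) < ((x.2.A)ᶜ.card : ℝ) := lt_of_lt_of_le (by positivity) hc
      exact_mod_cast this
    obtain ⟨g, hg0, hgK, hgl⟩ := hg _ hne hc
    have := h.sum_S_le_of_card hT0 hg0 hgK fun v hv => hgl v (by simpa using hv)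
    have : 0 ≤ migrationRate * t * potential T a₀ / (Fintype.card V * L) * ∑ v, x.2.E v := by
      positivity
    linarith
  · have hgood : Fintype.card V * (L : ℝ) ≤ ∑ v, x.2.E v := (not_le.1 hgood).le
    have h1 := mul_le_mul_of_nonneg_left h.sum_S_le hα.le
    have h2 : migrationRate * t * potential T a₀
        ≤ migrationRate * t * potential T a₀ / (Fintype.card V * L) * ∑ v, x.2.E v := by
      rw [div_mul_eq_mul_div, le_div_iff₀ (by positivity)]
      exact mul_le_mul_of_nonneg_left hgood (by positivity)
    linarith

variable (G T L) in
/-- The expectation after one round of a function of state and ledger. -/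
def roundOp : (State V m × Ledger V → ℝ) →ₗ[ℝ] (State V m × Ledger V → ℝ) :=
  ledgerOp (stepProb G T) (recordStep G T L)

theorem roundOp_sum_D_le (hd : ∀ v, 0 < G.degree v) (x : State V m × Ledger V) :
    roundOp G T L (fun y => ∑ v, y.2.D v) x ≤ ∑ v, x.2.D v + Fintype.card V := by
  rw [roundOp, ledgerOp_apply]
  simp only [recordStep, Finset.sum_add_distrib, mul_add]
  rw [← Finset.sum_mul, sum_stepProb, one_mul]
  simp only [Finset.mul_sum]
  rw [Finset.sum_comm]
  have : ∑ v, ∑ b, stepProb G T x.1 b * overdraft T 0 x.1 b v ≤ ∑ _v : V, (1 : ℝ) :=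
    Finset.sum_le_sum fun v _ => by simpa using sum_stepProb_overdraft_le (T := T) hd 0 x.1 v
  simp only [Finset.sum_const, nsmul_eq_mul, Finset.card_univ, mul_one] at this
  linarith

theorem roundOp_sum_E_le (hd : ∀ v, 0 < G.degree v) (x : State V m × Ledger V) :
    roundOp G T L (fun y => ∑ v, y.2.E v) x
      ≤ ∑ v, x.2.E v + Fintype.card V * (1 / 2) ^ L := by
  rw [roundOp, ledgerOp_apply]
  simp only [recordStep, Finset.sum_add_distrib, mul_add]
  rw [← Finset.sum_mul, sum_stepProb, one_mul]
  simp only [Finset.mul_sum]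
  rw [Finset.sum_comm]
  have : ∑ v, ∑ b, stepProb G T x.1 b * overdraft T L x.1 b v ≤ ∑ _v : V, (1 / 2 : ℝ) ^ L :=
    Finset.sum_le_sum fun v _ => sum_stepProb_overdraft_le (T := T) hd L x.1 v
  simp only [Finset.sum_const, nsmul_eq_mul, Finset.card_univ] at this
  linarith

/-- The noise is centred, so cross terms vanish, and its variance in a round, at most 2αΦ, is what
2αΣS gains. -/
theorem roundOp_sum_sq_le (hd : ∀ v, 0 < G.degree v) (x : State V m × Ledger V) :
    roundOp G T L (fun y => ∑ v, y.2.M v ^ 2 - 2 * migrationRate * ∑ v, y.2.S v) x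
      ≤ ∑ v, x.2.M v ^ 2 - 2 * migrationRate * ∑ v, x.2.S v := by
  obtain ⟨a, z⟩ := x
  rw [roundOp, ledgerOp_apply]
  have e : ∀ b, stepProb G T a b * (∑ v, (z.M v + (load b v - meanLoad G T a v)) ^ 2
        - 2 * migrationRate * ∑ v, (z.S v + potentialAt T a v))
      = stepProb G T a b * (∑ v, z.M v ^ 2 - 2 * migrationRate * ∑ v, z.S v
          - 2 * migrationRate * potential T a)
        + (∑ v, 2 * z.M v * (stepProb G T a b * (load b v - meanLoad G T a v))
          + ∑ v, stepProb G T a b * (load b v - meanLoad G T a v) ^ 2) := fun b => by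
    have h5 : (potential T a : ℝ) = ∑ v, (potentialAt T a v : ℝ) := by
      unfold potential; push_cast; rfl
    have h6 : ∑ v, (z.M v + (load b v - meanLoad G T a v)) ^ 2
        = ∑ v, z.M v ^ 2 + (∑ v, 2 * z.M v * (load b v - meanLoad G T a v)
          + ∑ v, (load b v - meanLoad G T a v) ^ 2) := by
      rw [← Finset.sum_add_distrib, ← Finset.sum_add_distrib]
      exact Finset.sum_congr rfl fun v _ => by ring
    have h7 : ∑ v, 2 * z.M v * (stepProb G T a b * (load b v - meanLoad G T a v))
        = stepProb G T a b * ∑ v, 2 * z.M v * (load b v - meanLoad G T a v) := by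
      rw [Finset.mul_sum]
      exact Finset.sum_congr rfl fun v _ => by ring
    rw [h6, h7, ← Finset.mul_sum, Finset.sum_add_distrib, ← h5]
    ring
  simp only [recordStep, e]
  rw [Finset.sum_add_distrib, ← Finset.sum_mul, sum_stepProb, Finset.sum_add_distrib]
  have h0 : ∑ v, ∑ b, 2 * z.M v * (stepProb G T a b * (load b v - meanLoad G T a v)) = 0 :=
    Finset.sum_eq_zero fun v _ => by rw [← Finset.mul_sum, sum_stepProb_load_sub hd, mul_zero]
  have := sum_stepProb_sum_sq_le (T := T) hd a
  rw [Finset.sum_comm] at h0 this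
  rw [h0]
  linarith

/-- The arithmetic of the window, with X, D, E, M, P the expectations of ΣS, ΣD, ΣE, ΣM² and the
final potential. Half of rX absorbs M; the length 100K makes KΦ small against tr·Φ, and Φ ≥ 2000nK
does the same for the terms in n. -/
theorem half_bound {n Φ K tr r l X D E M P : ℝ} (hnr : 0 < n) (hΦ0 : 0 ≤ Φ) (hK : 1 ≤ K)
    (ht1 : 100 * K ≤ tr) (ht2 : tr ≤ 101 * K) (hr : 0 < r) (hr6 : 1 / 6 ≤ r) (hl : 32 ≤ l)
    (hD : D ≤ n * tr) (hE : E ≤ n) (hM : M ≤ 2 * r * X) (hP : tr * P ≤ X + tr * D)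
    (hS : r * X ≤ (K * Φ + n * K ^ 2) + (K + r * tr) * D + (1 / 4) * M
      + r * tr * Φ / (n * l) * E) (hΦ : 2000 * (n * K) ≤ Φ) : P ≤ Φ / 2 := by
  have htr0 : 0 < tr := by linarith
  have hcE : r * tr * Φ / (n * l) * E ≤ r * (tr * Φ / 32) := by
    calc r * tr * Φ / (n * l) * E ≤ r * tr * Φ / (n * l) * n := by gcongr
      _ = r * (tr * Φ / l) := by field_simp
      _ ≤ _ := by gcongr
  have hKD : (K + r * tr) * D ≤ (K + r * tr) * (n * tr) := by gcongr
  have h1 : X / 2 ≤ 6 * (K * Φ + n * K ^ 2 + K * (n * tr)) + n * tr ^ 2 + tr * Φ / 32 := by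
    have h2 : r * (X / 2) ≤ (K * Φ + n * K ^ 2 + K * (n * tr))
        + r * (n * tr ^ 2) + r * (tr * Φ / 32) := by linarith
    have h3 : 1 / 6 * (6 * (K * Φ + n * K ^ 2 + K * (n * tr)))
        ≤ r * (6 * (K * Φ + n * K ^ 2 + K * (n * tr))) := by gcongr
    have h4 : r * (X / 2) ≤ r
        * (6 * (K * Φ + n * K ^ 2 + K * (n * tr)) + n * tr ^ 2 + tr * Φ / 32) := by linarith
    exact le_of_mul_le_mul_left h4 hr
  have hKt : K ≤ tr / 100 := by linarith
  have hnK : 0 ≤ n * K := by positivity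
  have h2 : K * Φ ≤ tr / 100 * Φ := by gcongr
  have h3 : tr * (2000 * (n * K)) ≤ tr * Φ := by gcongr
  have h4 : n * K * K ≤ n * K * tr := by gcongr; linarith
  have h5 : n * tr * tr ≤ n * tr * (101 * K) := by gcongr
  have h6 : tr * D ≤ tr * (n * tr) := by gcongr
  have h8 : 0 ≤ tr * Φ := by positivity
  have h7 : tr * P ≤ tr * (Φ / 2) := by linarith
  exact le_of_mul_le_mul_left h7 htr0

/-- Over a window of suitable length the expected potential is halved. -/
theorem iterate_stateOp_potential_le (hd : ∀ v, 0 < G.degree v) {ε τ K : ℝ} (hε : 0 < ε)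
    (hε1 : ε ≤ 1) (hn : 0 < Fintype.card V) (hT0 : ∀ v, 0 ≤ T v)
    (hm : (m : ℝ) ≤ Fintype.card V * τ) (hT : ∀ v, (1 + ε) * τ ≤ T v) (hL1 : 32 ≤ L)
    (hL : 8 * L + 4 ≤ ε * τ) (hK : 1 ≤ K)
    (hg : ∀ U : Finset V, U.Nonempty → Fintype.card V * (ε / 4) ≤ (U.card : ℝ) →
      ∃ g : V → ℝ, (∀ v, 0 ≤ g v) ∧ (∀ v, g v ≤ K) ∧ ∀ v ∉ U, 1 ≤ g v - walkOp G g v)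
    {t : ℕ} (ht1 : 100 * K ≤ t) (ht2 : t ≤ 101 * K) (htL : (t : ℝ) ≤ 2 ^ L)
    (a₀ : State V m) (ha₀ : 2000 * (Fintype.card V * K) ≤ potential T a₀) :
    (stateOp (stepProb G T))^[t] (fun a => (potential T a : ℝ)) a₀ ≤ potential T a₀ / 2 := by
  have hp := stepProb_nonneg (G := G) (T := T) (m := m)
  have hp1 := sum_stepProb (G := G) (T := T) (m := m)
  have hα := migrationRate_pos
  have hα6 := one_sixth_le_migrationRate
  set x₀ : State V m × Ledger V := (a₀, initialLedger T a₀) with hx₀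
  set R := roundOp G T L (m := m) with hR
  set n : ℝ := (Fintype.card V : ℝ) with hndef
  have hnr : 0 < n := by rw [hndef]; exact_mod_cast hn
  set Φ : ℝ := (potential T a₀ : ℝ) with hΦ
  set tr : ℝ := (t : ℝ) with htr
  have hLr : (32 : ℝ) ≤ L := by exact_mod_cast hL1
  let fS : State V m × Ledger V → ℝ := fun y => ∑ v, y.2.S v
  let fD : State V m × Ledger V → ℝ := fun y => ∑ v, y.2.D v
  let fE : State V m × Ledger V → ℝ := fun y => ∑ v, y.2.E v
  let fM : State V m × Ledger V → ℝ := fun y => ∑ v, y.2.M v ^ 2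
  let fP : State V m × Ledger V → ℝ := fun y => (potential T y.1 : ℝ)
  have hD : (R ^ t) fD x₀ ≤ n * tr := by
    have := ledgerOp_pow_le hp hp1 (roundOp_sum_D_le (T := T) (L := L) (m := m) hd) t x₀
    have h0 : ∑ v, x₀.2.D v = 0 := by simp [hx₀, initialLedger]
    rw [h0] at this
    exact this.trans_eq (by ring)
  have hE : (R ^ t) fE x₀ ≤ n := by
    have := ledgerOp_pow_le hp hp1 (roundOp_sum_E_le (T := T) (L := L) (m := m) hd) t x₀
    have h0 : ∑ v, x₀.2.E v = 0 := by simp [hx₀, initialLedger]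
    rw [h0] at this
    refine this.trans ?_
    -- The window is short enough that overdrafts beyond L total at most n in expectation.
    have : tr * (1 / 2) ^ L ≤ 1 := by
      rw [one_div, inv_pow, ← div_eq_mul_inv]
      exact div_le_one_of_le₀ htL (by positivity)
    calc 0 + tr * (n * (1 / 2) ^ L) = n * (tr * (1 / 2) ^ L) := by ring
      _ ≤ n * 1 := by gcongr
      _ = n := mul_one _
  have hM : (R ^ t) fM x₀ ≤ 2 * migrationRate * (R ^ t) fS x₀ := by
    have := ledgerOp_pow_le (c := 0) hp hp1
      (fun x => (roundOp_sum_sq_le (T := T) (L := L) (m := m) hd x).trans_eq (add_zero _).symm) t x₀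
    have h0 : ∑ v, x₀.2.M v ^ 2 - 2 * migrationRate * ∑ v, x₀.2.S v = 0 := by
      simp [hx₀, initialLedger]
    rw [h0] at this
    have e : (R ^ t) (fM - (2 * migrationRate) • fS) x₀ ≤ 0 := this.trans_eq (by ring)
    rw [map_sub, map_smul, Pi.sub_apply, Pi.smul_apply, smul_eq_mul] at e
    linarith
  have hstep : ∀ k x (b : State V m), IsLedger G T L a₀ k x →
      IsLedger G T L a₀ (k + 1) (b, recordStep G T L x.1 b x.2) := fun k x b h => h.step hT0 b
  have hP : tr * (R ^ t) fP x₀ ≤ (R ^ t) fS x₀ + tr * (R ^ t) fD x₀ := by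
    have := ledgerOp_pow_mono hp hstep (F := tr • fP) (H := fS + tr • fD) t 0 x₀
      (isLedger_initial a₀) (by rw [zero_add]; exact fun y hy => hy.mul_potential_le)
    change (R ^ t) _ _ ≤ (R ^ t) _ _ at this
    rwa [map_add, map_smul, map_smul] at this
  set c : ℝ := migrationRate * tr * Φ / (n * L) with hc
  have hS : migrationRate * (R ^ t) fS x₀ ≤ (K * Φ + n * K ^ 2)
      + (K + migrationRate * tr) * (R ^ t) fD x₀ + (1 / 4) * (R ^ t) fM x₀
      + c * (R ^ t) fE x₀ := by
    have := ledgerOp_pow_mono hp hstep (F := migrationRate • fS)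
      (H := (fun _ => K * Φ + n * K ^ 2) + (K + migrationRate * tr) • fD + (1 / 4 : ℝ) • fM + c • fE)
      t 0 x₀ (isLedger_initial a₀) (by
        rw [zero_add]
        exact fun y hy => hy.sum_S_bound hε hε1 hn hT0 hm hT (by omega) hL (by linarith) hg)
    change (R ^ t) _ _ ≤ (R ^ t) _ _ at this
    rw [map_add, map_add, map_add, map_smul, map_smul, map_smul, map_smul] at this
    have hconst : (R ^ t) (fun _ => K * Φ + n * K ^ 2) = fun _ => K * Φ + n * K ^ 2 :=
      ledgerOp_pow_const hp1 _ t
    rw [hconst] at this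
    exact this
  have hfin : (R ^ t) fP x₀ = (stateOp (stepProb G T))^[t] (fun a => (potential T a : ℝ)) a₀ :=
    ledgerOp_pow_comp_fst (fun a => (potential T a : ℝ)) t x₀
  rw [← hfin]
  generalize (R ^ t) fS x₀ = X at *
  generalize (R ^ t) fD x₀ = D at *
  generalize (R ^ t) fE x₀ = E at *
  generalize (R ^ t) fM x₀ = M at *
  generalize (R ^ t) fP x₀ = P at *
  refine half_bound hnr (by rw [hΦ]; positivity) hK ht1 ht2 hα hα6 hLr hD hE hM hP ?_ ha₀
  rw [← hc]
  exact hS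

end Window

/-! ### From halving the potential to the expected hitting time. -/

section Hitting

open MeasureTheory ProbabilityTheory

variable {V : Type*} [Fintype V] [DecidableEq V] {m : ℕ}
variable {G : SimpleGraph V} [DecidableRel G.Adj] {T : V → ℝ}

instance : DiscreteMeasurableSpace (State V m) := ⟨fun _ => trivial⟩

instance : Finite (State V m) := inferInstanceAs (Finite (Fin m → V))

instance (a₀ : State V m) : IsProbabilityMeasure (protocolLaw G T a₀) := by
  unfold protocolLaw; infer_instance

variable (G T) in
/-- The expectation after one round, for functions with values in `ℝ≥0∞`. -/
def stateLOp (f : State V m → ℝ≥0∞) (a : State V m) : ℝ≥0∞ := ∑ b, roundLaw G T a b * f b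

theorem lintegral_roundKernel (f : State V m → ℝ≥0∞) (a : State V m) :
    ∫⁻ b, f b ∂(roundKernel G T a) = stateLOp G T f a := by
  rw [lintegral_fintype]
  refine Finset.sum_congr rfl fun b _ => ?_
  rw [mul_comm]
  congr 1
  exact PMF.toMeasure_apply_singleton _ _ (measurableSet_singleton b)

/-- The joint law of the past and the next state is the law of the past composed with the round
kernel. -/
theorem lintegral_protocolLaw_succ (a₀ : State V m) (s : ℕ)
    (F : ((i : Finset.Iic s) → State V m) → ℝ≥0∞) (f : State V m → ℝ≥0∞) :
    ∫⁻ ω, F (Preorder.frestrictLe s ω) * f (ω (s + 1)) ∂(protocolLaw G T a₀)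
      = ∫⁻ ω, F (Preorder.frestrictLe s ω) * stateLOp G T f (ω s) ∂(protocolLaw G T a₀) := by
  have hF : Measurable F := measurable_of_finite _
  have hf : Measurable f := measurable_from_top
  let κ : (t : ℕ) → Kernel ((i : Finset.Iic t) → State V m) (State V m) := fun t =>
    (roundKernel G T).comap
      (fun past : (Finset.Iic t) → State V m => past ⟨t, Finset.mem_Iic.2 le_rfl⟩)
      (measurable_pi_apply _)
  have hlaw : protocolLaw G T a₀ = Kernel.traj (X := fun _ => State V m) κ 0 (fun _ => a₀) := rfl
  have h := Kernel.partialTraj_compProd_eq_map_traj (X := fun _ => State V m) (κ := κ)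
    (Nat.zero_le s) (x₀ := fun _ => a₀)
  have hg : Measurable fun x : ((i : Finset.Iic s) → State V m) × State V m => F x.1 * f x.2 :=
    (hF.comp measurable_fst).mul (hf.comp measurable_snd)
  rw [hlaw]
  calc _ = ∫⁻ x, F x.1 * f x.2 ∂((Kernel.traj (X := fun _ => State V m) κ 0 (fun _ => a₀)).map
        (fun x ↦ (Preorder.frestrictLe s x, x (s + 1)))) := by
        rw [lintegral_map hg (by fun_prop)]
    _ = ∫⁻ y, F y * stateLOp G T f (y ⟨s, Finset.mem_Iic.2 le_rfl⟩)
          ∂(Kernel.partialTraj (X := fun _ => State V m) κ 0 s (fun _ => a₀)) := by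
        rw [← h, Measure.lintegral_compProd hg]
        refine lintegral_congr fun y => ?_
        dsimp only
        rw [lintegral_const_mul _ hf]
        congr 1
        exact lintegral_roundKernel f _
    _ = _ := by
        rw [← Kernel.traj_map_frestrictLe_apply, lintegral_map (measurable_of_finite _) (by fun_prop)]
        rfl

/-- The Markov property, for functions of the past and a later state. -/
theorem lintegral_protocolLaw_add (a₀ : State V m) (s j : ℕ) (F : (ℕ → State V m) → ℝ≥0∞)
    (hF : ∀ ω ω', (∀ i ≤ s, ω i = ω' i) → F ω = F ω') (f : State V m → ℝ≥0∞) :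
    ∫⁻ ω, F ω * f (ω (s + j)) ∂(protocolLaw G T a₀)
      = ∫⁻ ω, F ω * (stateLOp G T)^[j] f (ω s) ∂(protocolLaw G T a₀) := by
  induction j generalizing f with
  | zero => rfl
  | succ j ih =>
    rw [Function.iterate_succ_apply, ← ih]
    -- Freezing the trajectory after time s + j makes F a function of the restricted past without
    -- changing its value.
    have h := lintegral_protocolLaw_succ (G := G) (T := T) a₀ (s + j)
      (fun x => F fun i => x ⟨min i (s + j), Finset.mem_Iic.2 (min_le_right _ _)⟩) f
    have e : ∀ ω : ℕ → State V m,
        (F fun i => Preorder.frestrictLe (π := fun _ => State V m) (s + j) ω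
          ⟨min i (s + j), Finset.mem_Iic.2 (min_le_right _ _)⟩) = F ω := fun ω => by
      refine hF _ _ fun i hi => ?_
      simp only [Preorder.frestrictLe_apply]
      rw [min_eq_left (by omega)]
    simp only [e] at h
    exact h

theorem stateLOp_ofReal {f : State V m → ℝ} (hf : ∀ a, 0 ≤ f a) (a : State V m) :
    stateLOp G T (fun b => ENNReal.ofReal (f b)) a
      = ENNReal.ofReal (stateOp (stepProb G T) f a) := by
  unfold stateLOp stateOp
  rw [ENNReal.ofReal_sum_of_nonneg fun b _ => mul_nonneg (stepProb_nonneg a b) (hf b)]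
  refine Finset.sum_congr rfl fun b _ => ?_
  rw [roundLaw_eq, ENNReal.ofReal_mul (stepProb_nonneg a b)]

theorem iterate_stateOp_nonneg {f : State V m → ℝ} (hf : ∀ a, 0 ≤ f a) (j : ℕ) (a : State V m) :
    0 ≤ (stateOp (stepProb G T))^[j] f a := by
  induction j generalizing a with
  | zero => exact hf a
  | succ j ih =>
    rw [Function.iterate_succ_apply']
    exact Finset.sum_nonneg fun b _ => mul_nonneg (stepProb_nonneg a b) (ih b)

theorem iterate_stateLOp_ofReal {f : State V m → ℝ} (hf : ∀ a, 0 ≤ f a) (j : ℕ) :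
    (stateLOp G T)^[j] (fun b => ENNReal.ofReal (f b))
      = fun a => ENNReal.ofReal ((stateOp (stepProb G T))^[j] f a) := by
  induction j with
  | zero => rfl
  | succ j ih =>
    ext a
    rw [Function.iterate_succ_apply', Function.iterate_succ_apply', ih,
      stateLOp_ofReal (iterate_stateOp_nonneg hf j)]

open Classical in
/-- The indicator of the event that the potential exceeds `β` at the times `0, t, 2t, …, kt`. -/
def stillHigh (T : V → ℝ) (β : ℝ) (t k : ℕ) (ω : ℕ → State V m) : ℝ≥0∞ :=
  if ∀ i ≤ k, β < potential T (ω (i * t)) then 1 else 0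

theorem measurable_stillHigh (β : ℝ) (t k : ℕ) :
    Measurable (stillHigh (m := m) T β t k) := by
  refine Measurable.ite ?_ measurable_const measurable_const
  have : {ω : ℕ → State V m | ∀ i ≤ k, β < potential T (ω (i * t))}
      = ⋂ i, ⋂ (_ : i ≤ k), (fun ω => ω (i * t)) ⁻¹' {a | β < potential T a} := by
    ext; simp
  rw [this]
  exact MeasurableSet.iInter fun i => MeasurableSet.iInter fun _ =>
    measurable_pi_apply (i * t) MeasurableSpace.measurableSet_top

/-- Checking only multiples of t, each failed check costs t rounds; if all checks fail, the sum
diverges and the bound is ∞. -/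
theorem hittingRound_le (β : ℝ) {t : ℕ} (ht : 0 < t) (ω : ℕ → State V m) :
    hittingRound T β ω ≤ t * ∑' k, stillHigh T β t k ω := by
  classical
  by_cases h : ∃ k, (potential T (ω (k * t)) : ℝ) ≤ β
  · have h1 := Nat.find_spec h
    have h2 : ∀ k < Nat.find h, stillHigh T β t k ω = 1 := fun k hk => by
      rw [stillHigh, if_pos]
      intro i hi
      exact not_le.1 (Nat.find_min h (by omega))
    calc hittingRound T β ω ≤ ((Nat.find h * t : ℕ) : ℝ≥0∞) := iInf₂_le (Nat.find h * t) h1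
      _ = t * ∑ k ∈ Finset.range (Nat.find h), stillHigh T β t k ω := by
          rw [Finset.sum_congr rfl fun k hk => h2 k (Finset.mem_range.1 hk)]
          simp [mul_comm]
      _ ≤ _ := by gcongr; exact ENNReal.sum_le_tsum _
  · push Not at h
    have : ∀ k, stillHigh T β t k ω = 1 := fun k => if_pos fun i _ => h i
    simp only [this]
    rw [ENNReal.tsum_const_eq_top_of_ne_zero one_ne_zero, ENNReal.mul_top (by positivity)]
    exact le_top

/-- A potential above β ≥ 0 is an integer at least 1, so the indicator is at most the indicator
times Φ, whose expectation halves per window by the Markov property. -/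
theorem lintegral_stillHigh_le (a₀ : State V m) {β : ℝ} (hβ : 0 ≤ β) (t : ℕ)
    (h : ∀ a : State V m, β < potential T a →
      (stateOp (stepProb G T))^[t] (fun b => (potential T b : ℝ)) a ≤ potential T a / 2) (k : ℕ) :
    ∫⁻ ω, stillHigh T β t k ω ∂(protocolLaw G T a₀) ≤ (1 / 2) ^ k * m := by
  let f : State V m → ℝ≥0∞ := fun a => ENNReal.ofReal (potential T a)
  have hmain : ∫⁻ ω, stillHigh T β t k ω * f (ω (k * t)) ∂(protocolLaw G T a₀)
      ≤ (1 / 2) ^ k * m := by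
    induction k with
    | zero =>
      calc _ ≤ ∫⁻ _ω, (m : ℝ≥0∞) ∂(protocolLaw G T a₀) := by
            refine lintegral_mono fun ω => ?_
            have h1 : stillHigh T β t 0 ω ≤ 1 := by unfold stillHigh; split_ifs <;> simp
            have h2 : f (ω (0 * t)) ≤ m := by
              simp only [f, ENNReal.ofReal_natCast]
              exact_mod_cast potential_le _
            calc _ ≤ 1 * (m : ℝ≥0∞) := mul_le_mul' h1 h2
              _ = m := one_mul _
        _ = _ := by simp
    | succ k ih =>
      have hmarkov := lintegral_protocolLaw_add (G := G) (T := T) a₀ (k * t) t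
        (stillHigh T β t k) (fun ω ω' hω => by
          unfold stillHigh
          congr 1
          refine propext (forall₂_congr fun i hi => ?_)
          rw [hω (i * t) (Nat.mul_le_mul_right t hi)]) f
      rw [iterate_stateLOp_ofReal (fun a => by positivity)] at hmarkov
      calc _ ≤ ∫⁻ ω, stillHigh T β t k ω * f (ω (k * t + t)) ∂(protocolLaw G T a₀) := by
            refine lintegral_mono fun ω => ?_
            rw [Nat.succ_mul]
            refine mul_le_mul' ?_ le_rfl
            unfold stillHigh
            by_cases hk : ∀ i ≤ k, β < potential T (ω (i * t))
            · rw [if_pos hk]; split_ifs <;> simp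
            · rw [if_neg hk, if_neg fun h' => hk fun i hi => h' i (by omega)]
        _ ≤ ∫⁻ ω, (1 / 2) * (stillHigh T β t k ω * f (ω (k * t))) ∂(protocolLaw G T a₀) := by
            rw [hmarkov]
            refine lintegral_mono fun ω => ?_
            unfold stillHigh
            split_ifs with hk
            · have h1 := ENNReal.ofReal_le_ofReal (h _ (hk k le_rfl))
              rw [div_eq_inv_mul, ENNReal.ofReal_mul (by norm_num)] at h1
              rw [one_mul, one_mul]
              refine h1.trans_eq ?_
              congr 1
              rw [ENNReal.ofReal_inv_of_pos (by norm_num)]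
              simp
            · simp
        _ ≤ (1 / 2) * ((1 / 2) ^ k * m) := by
            rw [lintegral_const_mul' _ _ (by simp)]
            gcongr
        _ = _ := by rw [pow_succ']; ring
  refine le_trans (lintegral_mono fun ω => ?_) hmain
  unfold stillHigh
  split_ifs with hk
  · rw [one_mul, ENNReal.one_le_ofReal]
    have : (0 : ℝ) < potential T (ω (k * t)) := lt_of_le_of_lt hβ (hk k le_rfl)
    have : 0 < potential T (ω (k * t)) := by exact_mod_cast this
    exact_mod_cast this
  · simp

/-- If high potentials are halved in expectation within `t` rounds, the potential becomes low
within `O(t log m)` rounds in expectation. -/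
theorem expectedRounds_le (a₀ : State V m) {β : ℝ} (hβ : 0 ≤ β) {t l : ℕ} (ht : 0 < t)
    (hl : m ≤ 2 ^ l)
    (h : ∀ a : State V m, β < potential T a →
      (stateOp (stepProb G T))^[t] (fun b => (potential T b : ℝ)) a ≤ potential T a / 2) :
    expectedRounds G T a₀ β ≤ t * (l + 2) := by
  have h1 : ∀ k, ∫⁻ ω, stillHigh T β t k ω ∂(protocolLaw G T a₀) ≤ 1 := fun k => by
    calc _ ≤ ∫⁻ _ω, (1 : ℝ≥0∞) ∂(protocolLaw G T a₀) :=
          lintegral_mono fun ω => by unfold stillHigh; split_ifs <;> simp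
      _ = 1 := by simp
  have h2 : ∀ k, ∫⁻ ω, stillHigh T β t (k + l) ω ∂(protocolLaw G T a₀) ≤ (1 / 2) ^ k := fun k => by
    refine (lintegral_stillHigh_le a₀ hβ t h (k + l)).trans ?_
    rw [pow_add, mul_assoc]
    refine mul_le_of_le_one_right (by positivity) ?_
    have : (m : ℝ≥0∞) ≤ 2 ^ l := by exact_mod_cast hl
    calc (1 / 2 : ℝ≥0∞) ^ l * m ≤ (1 / 2) ^ l * 2 ^ l := by gcongr
      _ = 1 := by
        rw [← mul_pow, one_div, ENNReal.inv_mul_cancel (by norm_num) (by norm_num), one_pow]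
  have hsplit := Summable.sum_add_tsum_nat_add' (k := l)
    (f := fun k => ∫⁻ ω, stillHigh T β t k ω ∂(protocolLaw G T a₀)) ENNReal.summable
  calc expectedRounds G T a₀ β
      ≤ ∫⁻ ω, t * ∑' k, stillHigh T β t k ω ∂(protocolLaw G T a₀) :=
        lintegral_mono fun ω => hittingRound_le β ht ω
    _ = t * ∑' k, ∫⁻ ω, stillHigh T β t k ω ∂(protocolLaw G T a₀) := by
        rw [lintegral_const_mul' _ _ (by simp),
          lintegral_tsum fun k => (measurable_stillHigh β t k).aemeasurable]
    _ ≤ t * (l + 2) := by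
        gcongr
        -- The first l terms are at most 1 each; the rest form a geometric series with sum 2.
        rw [← hsplit]
        refine add_le_add ?_ ?_
        · refine (Finset.sum_le_sum fun k _ => h1 k).trans ?_
          simp
        · refine (ENNReal.tsum_le_tsum h2).trans ?_
          rw [ENNReal.tsum_geometric]
          simp

end Hitting

/-! ### Degenerate cases and the choice of parameters. -/

section Parameters

variable {V : Type*} [Fintype V] [DecidableEq V] {m : ℕ}
variable {G : SimpleGraph V} [DecidableRel G.Adj] {T : V → ℝ}

theorem expectedRounds_eq_zero (a₀ : State V m) {β : ℝ}
    (h : ∀ a : State V m, (potential T a : ℝ) ≤ β) : expectedRounds G T a₀ β = 0 := by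
  have : ∀ ω : ℕ → State V m, hittingRound T β ω = 0 := fun ω =>
    le_antisymm ((iInf₂_le 0 (h (ω 0))).trans (by simp)) (zero_le)
  unfold expectedRounds
  simp [this]

theorem le_card_mul_avgLoad (hn : 0 < Fintype.card V) (m : ℕ) :
    (m : ℝ) ≤ Fintype.card V * avgLoad (Fintype.card V) m := by
  have hnr : (0 : ℝ) < Fintype.card V := by exact_mod_cast hn
  rw [mul_comm, ← div_le_iff₀ hnr]
  exact Nat.le_ceil _

/-- Needed because the claimed bound is 0 when m ≤ 1; a single user fits under every threshold. -/
theorem potential_eq_zero_of_le_one (hn : 0 < Fintype.card V) (hm : m ≤ 1) {ε : ℝ} (hε : 0 < ε)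
    (hT : ∀ v, (1 + ε) * (avgLoad (Fintype.card V) m : ℝ) ≤ T v) (a : State V m) :
    potential T a = 0 := by
  have hnr : (0 : ℝ) < Fintype.card V := by exact_mod_cast hn
  refine Finset.sum_eq_zero fun v _ => ?_
  have hT0 : 0 ≤ T v := le_trans (by positivity) (hT v)
  rw [potentialAt_eq hT0]
  have h1 : load a v ≤ m := (Finset.single_le_sum (f := fun v => load a v)
    (fun _ _ => Nat.zero_le _) (Finset.mem_univ v)).trans (sum_load a).le
  rcases Nat.eq_zero_or_pos m with h0 | h0
  · omega
  · have h2 : 0 < avgLoad (Fintype.card V) m := Nat.ceil_pos.2 (by positivity)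
    have h3 : 1 ≤ ⌊T v⌋₊ := by
      rw [Nat.le_floor_iff hT0, Nat.cast_one]
      have : (1 : ℝ) ≤ avgLoad (Fintype.card V) m := by exact_mod_cast h2
      have h4 := hT v
      nlinarith
    omega

theorem minDegree_le_avgDegree (hn : 0 < Fintype.card V) :
    (G.minDegree : ℝ) ≤ avgDegree G := by
  have hnr : (0 : ℝ) < Fintype.card V := by exact_mod_cast hn
  rw [avgDegree, le_div_iff₀ hnr]
  calc (G.minDegree : ℝ) * Fintype.card V = ∑ _v : V, (G.minDegree : ℝ) := by
        simp [mul_comm]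
    _ ≤ _ := Finset.sum_le_sum fun v _ => by exact_mod_cast G.minDegree_le_degree v

theorem four_mul_log_le_mixTime :
    4 * Real.log (Fintype.card V) ≤ mixTime G := by
  have h : (0 : ℝ) ≤ Real.log (Fintype.card V) := Real.log_natCast_nonneg _
  exact le_div_self (by positivity) (spectralMu_pos G) (spectralMu_le_one G)

/-- Here vol(V)/vol(U) ≤ (d/δ)·n/|U|, and n/|U| is at most 4/ε and at most n. The second bound keeps
the window below a length free of ε, so that L need not depend on ε. -/
theorem exists_bounded_laplacian_ge_one (hG : G.Connected) (hd : ∀ v, 0 < G.degree v)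
    (hδ : 0 < G.minDegree) (hn : 2 ≤ Fintype.card V) {ε : ℝ} (hε : 0 < ε) {U : Finset V}
    (hU : U.Nonempty) (hUε : Fintype.card V * (ε / 4) ≤ (U.card : ℝ)) :
    ∃ g : V → ℝ, (∀ v, 0 ≤ g v) ∧
      (∀ v, g v ≤ 6 * (avgDegree G / G.minDegree * mixTime G) * min (Fintype.card V : ℝ) (4 / ε)) ∧
      ∀ v ∉ U, 1 ≤ g v - walkOp G g v := by
  obtain ⟨g, hg0, hgK, hg⟩ := exists_laplacian_ge_one hG hd hn hU
  refine ⟨g, hg0, fun v => (hgK v).trans ?_, hg⟩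
  have hnr : (0 : ℝ) < Fintype.card V := by exact_mod_cast (by omega : 0 < Fintype.card V)
  have hδr : (0 : ℝ) < G.minDegree := by exact_mod_cast hδ
  have hUr : (1 : ℝ) ≤ U.card := by exact_mod_cast hU.card_pos
  have hmix : 0 ≤ mixTime G :=
    (mul_nonneg (by norm_num) (Real.log_natCast_nonneg _)).trans four_mul_log_le_mixTime
  have havg : 0 ≤ avgDegree G := hδr.le.trans (minDegree_le_avgDegree (by omega))
  have hvol : ∑ v, (G.degree v : ℝ) = Fintype.card V * avgDegree G := by
    rw [avgDegree]; field_simp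
  have hvolU : U.card * (G.minDegree : ℝ) ≤ ∑ v ∈ U, (G.degree v : ℝ) := by
    rw [← nsmul_eq_mul, ← Finset.sum_const]
    exact Finset.sum_le_sum fun v _ => by exact_mod_cast G.minDegree_le_degree v
  have hratio : (Fintype.card V : ℝ) / U.card ≤ min (Fintype.card V : ℝ) (4 / ε) := by
    refine le_min (div_le_self hnr.le hUr) ?_
    rw [div_le_div_iff₀ (by linarith) hε]
    linarith
  calc 6 * mixTime G * ((∑ v, (G.degree v : ℝ)) / ∑ v ∈ U, (G.degree v : ℝ))
      ≤ 6 * mixTime G * (Fintype.card V * avgDegree G / (U.card * (G.minDegree : ℝ))) := by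
        rw [hvol]; gcongr
    _ = 6 * (avgDegree G / G.minDegree * mixTime G) * (Fintype.card V / U.card) := by
        field_simp
    _ ≤ _ := by gcongr

/-- The factors 606, κ and n are at most exp(5κ), exp κ and exp κ, while 20 log 2 > 7. -/
theorem window_le_two_pow {κ n : ℝ} (hκ : 27 / 10 ≤ κ) (hn : 1 ≤ n)
    (hκn : 4 * Real.log n ≤ κ) {L : ℕ} (hL : 20 * κ ≤ L) : 606 * κ * n ≤ 2 ^ L := by
  have hlog := Real.log_two_gt_d9
  have h1 := Real.add_one_le_exp κ
  have h2 : n ≤ Real.exp κ := by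
    rw [← Real.log_le_iff_le_exp (by linarith)]
    linarith [Real.log_nonneg hn]
  have h3 : (606 : ℝ) ≤ Real.exp κ ^ 5 := by
    calc (606 : ℝ) ≤ (37 / 10) ^ 5 := by norm_num
      _ ≤ Real.exp κ ^ 5 := pow_le_pow_left₀ (by norm_num) (by linarith) 5
  calc 606 * κ * n ≤ Real.exp κ ^ 5 * Real.exp κ * Real.exp κ := by
        gcongr; linarith
    _ = Real.exp (7 * κ) := by
        rw [mul_comm 7 κ, Real.exp_mul]
        norm_cast
    _ ≤ Real.exp (L * Real.log 2) := by
        refine Real.exp_le_exp.2 ?_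
        calc 7 * κ ≤ 20 * κ * (69 / 100) := by linarith
          _ ≤ L * Real.log 2 := by gcongr; linarith
    _ = 2 ^ L := by rw [Real.exp_nat_mul, Real.exp_log (by norm_num)]

theorem clog_add_two_le (hm : 2 ≤ m) : (Nat.clog 2 m : ℝ) + 2 ≤ 6 * Real.log m := by
  have hlog := Real.log_two_gt_d9
  have hlm : Real.log 2 ≤ Real.log m := Real.log_le_log (by norm_num) (by exact_mod_cast hm)
  have h1 : (2 : ℝ) ^ (Nat.clog 2 m - 1) ≤ m := by
    exact_mod_cast (Nat.pow_pred_clog_lt_self (by norm_num) (by omega)).le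
  have h2 := Real.log_le_log (by positivity) h1
  have hc : 1 ≤ Nat.clog 2 m := Nat.clog_pos (by norm_num) hm
  rw [Real.log_pow, Nat.cast_sub hc, Nat.cast_one] at h2
  have h3 : ((Nat.clog 2 m : ℝ) - 1) * (69 / 100) ≤ Real.log m := by
    have : (1 : ℝ) ≤ Nat.clog 2 m := by exact_mod_cast hc
    nlinarith
  linarith

end Parameters

end ThresholdBalancing

end

/-! ### The theorem. -/

open ThresholdBalancing in
theorem theorem6 :
    ∃ C₁ C₂ : ℝ, 0 < C₁ ∧ 0 < C₂ ∧
      ∀ (V : Type*) [Fintype V] [DecidableEq V] (G : SimpleGraph V) [DecidableRel G.Adj],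
        G.Connected → 2 ≤ Fintype.card V →
      ∀ (m : ℕ) (T : V → ℝ) (ε : ℝ), 0 < ε →
        (∀ v, (1 + ε) * (ThresholdBalancing.avgLoad (Fintype.card V) m : ℝ) ≤ T v) →
      ∀ a₀ : ThresholdBalancing.State V m,
        ThresholdBalancing.expectedRounds G T a₀
            (C₁ * (Fintype.card V * (ThresholdBalancing.avgDegree G / (G.minDegree * min ε 1))
              * ThresholdBalancing.mixTime G))
          ≤ ENNReal.ofReal
            (C₂ * (1 / min ε 1 * (ThresholdBalancing.avgDegree G / G.minDegree)
              * ThresholdBalancing.mixTime G * Real.log m)) := by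
  -- 48000 = 2000 · 24, from the window estimate and K ≤ 24κ/ε; 15000 rounds up 101 · 24 · 6, from
  -- the window length and the bound 6 log m on the number of windows.
  refine ⟨48000, 15000, by norm_num, by norm_num, ?_⟩
  intro V _ _ G _ hG hn m T ε₀ hε₀ hT₀ a₀
  have : Nontrivial V := Fintype.one_lt_card_iff_nontrivial.1 hn
  have hδ : 0 < G.minDegree := hG.preconnected.minDegree_pos_of_nontrivial
  have hd : ∀ v, 0 < G.degree v := fun v => hδ.trans_le (G.minDegree_le_degree v)
  have hn0 : 0 < Fintype.card V := by omega
  set ε := min ε₀ 1 with hεdef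
  have hε : 0 < ε := lt_min hε₀ one_pos
  have hε1 : ε ≤ 1 := min_le_right _ _
  set τ : ℝ := (avgLoad (Fintype.card V) m : ℝ) with hτ
  have hτ0 : 0 ≤ τ := by positivity
  have hT0 : ∀ v, 0 ≤ T v := fun v => le_trans (by positivity) (hT₀ v)
  have hT : ∀ v, (1 + ε) * τ ≤ T v := fun v =>
    le_trans (by gcongr; exact min_le_left _ _) (hT₀ v)
  have hδr : (0 : ℝ) < G.minDegree := by exact_mod_cast hδ
  have hmτ := le_card_mul_avgLoad hn0 m
  have hmix := four_mul_log_le_mixTime (G := G)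
  have havg := minDegree_le_avgDegree (G := G) hn0
  have hgap := fun (U : Finset V) hU hUε =>
    exists_bounded_laplacian_ge_one hG hd hδ hn hε (U := U) hU hUε
  have hnr : (2 : ℝ) ≤ Fintype.card V := by exact_mod_cast hn
  set n : ℝ := (Fintype.card V : ℝ) with hndef
  have hlogn : Real.log 2 ≤ Real.log n := Real.log_le_log (by norm_num) hnr
  have hlog2 := Real.log_two_gt_d9
  set κ := avgDegree G / G.minDegree * mixTime G with hκdef
  have hκmix : mixTime G ≤ κ := le_mul_of_one_le_left (by linarith) ((one_le_div hδr).2 havg)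
  have hκ : 27 / 10 ≤ κ := by linarith
  have hβ : n * (avgDegree G / (G.minDegree * ε)) * mixTime G = n * (κ / ε) := by
    rw [hκdef]; field_simp
  have hγ : 1 / ε * (avgDegree G / G.minDegree) * mixTime G * Real.log m
      = κ / ε * Real.log m := by
    rw [hκdef]; field_simp
  rw [hβ, hγ]
  have hβ0 : 0 ≤ 48000 * (n * (κ / ε)) := by positivity
  rcases Nat.lt_or_ge 1 m with hm | hm
  swap
  · rw [expectedRounds_eq_zero a₀ fun a => ?_]
    · exact zero_le
    · rw [potential_eq_zero_of_le_one hn0 hm hε₀ hT₀]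
      exact_mod_cast hβ0
  set ν := min n (4 / ε) with hν
  have hν1 : 1 ≤ ν := le_min (by linarith) ((one_le_div hε).2 (by linarith))
  have hνn : ν ≤ n := min_le_left _ _
  have hνε : ν ≤ 4 / ε := min_le_right _ _
  set K := 6 * κ * ν with hKdef
  have hK : 1 ≤ K := by
    calc (1 : ℝ) ≤ 6 * κ * 1 := by linarith
      _ ≤ 6 * κ * ν := by gcongr
  have hKε : K ≤ 24 * (κ / ε) := by
    calc 6 * κ * ν ≤ 6 * κ * (4 / ε) := by gcongr
      _ = _ := by ring
  set t := ⌈100 * K⌉₊ with ht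
  have ht1 : 100 * K ≤ t := Nat.le_ceil _
  have ht2 : (t : ℝ) ≤ 101 * K := by
    have := Nat.ceil_lt_add_one (a := 100 * K) (by linarith)
    linarith
  have ht0 : 0 < t := Nat.ceil_pos.2 (by linarith)
  set L := ⌈20 * κ⌉₊ with hLdef
  have hL1 : 20 * κ ≤ L := Nat.le_ceil _
  have hL2 : (L : ℝ) < 20 * κ + 1 := Nat.ceil_lt_add_one (by linarith)
  have hL32 : 32 ≤ L := by
    have : (32 : ℝ) ≤ L := by linarith
    exact_mod_cast this
  have htL : (t : ℝ) ≤ 2 ^ L := by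
    refine le_trans ?_ (window_le_two_pow hκ (by linarith) (hmix.trans hκmix) hL1)
    calc (t : ℝ) ≤ 101 * K := ht2
      _ = 606 * κ * ν := by rw [hKdef]; ring
      _ ≤ _ := by gcongr
  refine (expectedRounds_le a₀ hβ0 ht0 (Nat.le_pow_clog (by norm_num) m) fun a ha => ?_).trans ?_
  · have hma : (potential T a : ℝ) ≤ m := by exact_mod_cast potential_le a
    -- A potential above the target is at most m ≤ nτ, so τ is large; this supplies the slack 8L + 4
    -- ≤ ετ without any assumption on m.
    have hτκ : 48000 * κ ≤ ε * τ := by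
      have h1 : n * (48000 * (κ / ε)) ≤ n * τ := by linarith
      have h2 := le_of_mul_le_mul_left h1 (by linarith)
      rw [← mul_div_assoc, div_le_iff₀ hε] at h2
      linarith
    refine iterate_stateOp_potential_le hd hε hε1 hn0 hT0 hmτ hT hL32 (by linarith) hK hgap ht1 ht2
      htL a ?_
    have : n * K ≤ n * (24 * (κ / ε)) := by gcongr
    linarith
  · have hlm := clog_add_two_le hm
    have hlm0 : 0 ≤ Real.log m := Real.log_natCast_nonneg m
    have e : (t : ℝ≥0∞) * ((Nat.clog 2 m : ℕ) + 2)
        = ENNReal.ofReal ((t : ℝ) * ((Nat.clog 2 m : ℝ) + 2)) := by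
      rw [ENNReal.ofReal_mul (by positivity), ENNReal.ofReal_add (by positivity) (by norm_num)]
      simp
    rw [e]
    refine ENNReal.ofReal_le_ofReal ?_
    have hκε : 0 ≤ κ / ε := by positivity
    calc (t : ℝ) * ((Nat.clog 2 m : ℝ) + 2)
        ≤ (101 * (24 * (κ / ε))) * (6 * Real.log m) := by
          gcongr
          linarith
      _ = 14544 * (κ / ε * Real.log m) := by ring
      _ ≤ 15000 * (κ / ε * Real.log m) := by
          gcongr
          norm_num
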